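/- Let $\Delta\subsetneq\mathbb C$ be a simply connected domain, let $f:\mathbb D\to\Delta$ be a Riemann map (a biholomorphism of the open unit disc $\mathbb D$ onto $\Delta$), and let $\{z_n\}\subset\Delta$ be a compactly divergent sequence, i.e. a sequence with no accumulation points in $\Delta$. Then the following are equivalent. (A) There is a point $\sigma\in\partial\mathbb D$ such that $\{f^{-1}(z_n)\}$ converges non-tangentially to $\sigma$, that is, $f^{-1}(z_n)\to\sigma$ and, for some $M>1$, $f^{-1}(z_n)$ is eventually contained in $\{\zeta\in\mathbb D: |\sigma-\zeta|<M(1-|\zeta|)\}$. (B) There exist a simply connected domain $U\subsetneq\mathbb C$, a geodesic $\gamma:[0,+\infty)\to U$ of $U$ with $\lim_{t\to+\infty}k_U(\gamma(t),\gamma(0))=+\infty$, and real numbers $R>R_0>0$ such that 1. $S_U(\gamma,R)\subseteq\Delta\subseteq U$, and 2. there exists $n_0\ge 0$ such that $z_n\in S_U(\gamma,R_0)$ for all $n\ge n_0$. Here, for a simply connected domain $U\subsetneq\mathbb C$, $z\in U$ and $v\in\mathbb C$, $\kappa_U(z;v)=|v|/g'(0)$, where $g:\mathbb D\to U$ is the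 Riemann map with $g(0)=z$ and $g'(0)>0$; the hyperbolic distance $k_U(z,w)$ is the infimum of $\int_0^1\kappa_U(\eta(t);\eta'(t))\,dt$ over all piecewise $C^1$-smooth curves $\eta:[0,1]\to U$ with $\eta(0)=z$, $\eta(1)=w$; a geodesic $\gamma:[0,+\infty)\to U$ is a $C^1$-smooth curve with nowhere vanishing derivative (one-sided at $0$) such that $\int_s^t\kappa_U(\gamma(u);\gamma'(u))\,du=k_U(\gamma(s),\gamma(t))$ for all $0\le s\le t$; and $S_U(\gamma,r)=\{w\in U:\inf_{t\ge0}k_U(w,\gamma(t))<r\}$ for $r>0$. -/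

import Mathlib

open Set Filter Topology

noncomputable section

namespace HypSector

/-- A simply connected domain `Δ ⊊ ℂ` (non-empty and path connected by `IsSimplyConnected`). -/
def IsProperSCDomain (Δ : Set ℂ) : Prop :=
  IsOpen Δ ∧ IsSimplyConnected Δ ∧ Δ ≠ univ

/-- `f` is a Riemann map of `Δ`: a biholomorphism from the open unit disc onto `Δ`
(only the values of `f` on the disc matter). -/
def IsRiemannMap (f : ℂ → ℂ) (Δ : Set ℂ) : Prop :=
  DifferentiableOn ℂ f (Metric.ball 0 1) ∧ BijOn f (Metric.ball 0 1) Δ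

/-- The infinitesimal hyperbolic metric `κ_Δ(z; v) = |v| / f'(0)`, where `f` is the Riemann map
of `Δ` with `f(0) = z` and `f'(0) > 0`. Such an `f` is unique on the disc, so for `z` in a simply
connected domain `Δ ⊊ ℂ` the set below has exactly one element and `sInf` picks it. -/
def kappa (Δ : Set ℂ) (z v : ℂ) : ℝ :=
  sInf {r : ℝ | ∃ f : ℂ → ℂ, IsRiemannMap f Δ ∧ f 0 = z ∧
    0 < (deriv f 0).re ∧ (deriv f 0).im = 0 ∧ r = ‖v‖ / (deriv f 0).re}

/-- Piecewise `C¹`-smooth curves on `[a, b]`: continuous, and `C¹` up to the end points on each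
closed interval of some finite partition `a = t 0 ≤ t 1 ≤ ⋯ ≤ t n = b`. -/
def IsPiecewiseC1 (γ : ℝ → ℂ) (a b : ℝ) : Prop :=
  ContinuousOn γ (Icc a b) ∧ ∃ (n : ℕ) (t : ℕ → ℝ), Monotone t ∧ t 0 = a ∧ t n = b ∧
    ∀ i < n, ContDiffOn ℝ 1 γ (Icc (t i) (t (i + 1)))

/-- The hyperbolic length `ℓ_Δ(γ; [s, t])`. -/
def hypLength (Δ : Set ℂ) (γ : ℝ → ℂ) (s t : ℝ) : ℝ :=
  ∫ u in s..t, kappa Δ (γ u) (deriv γ u)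

/-- The hyperbolic distance `k_Δ(z, w)`: the infimum of the hyperbolic lengths of the piecewise
`C¹`-smooth curves in `Δ` from `z` to `w`. -/
def hypDist (Δ : Set ℂ) (z w : ℂ) : ℝ :=
  sInf {L : ℝ | ∃ γ : ℝ → ℂ, IsPiecewiseC1 γ 0 1 ∧ MapsTo γ (Icc 0 1) Δ ∧
    γ 0 = z ∧ γ 1 = w ∧ L = hypLength Δ γ 0 1}

/-- `γ : I → Δ`, with `I` an interval, is a geodesic of `Δ`: it is `C¹`-smooth with nowhere
vanishing derivative (one-sided at end points of `I` that belong to `I`), and hyperbolic length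
along `γ` equals hyperbolic distance. -/
def IsGeodesic (Δ : Set ℂ) (γ : ℝ → ℂ) (I : Set ℝ) : Prop :=
  MapsTo γ I Δ ∧ ContDiffOn ℝ 1 γ I ∧ (∀ t ∈ I, derivWithin γ I t ≠ 0) ∧
    ∀ s ∈ I, ∀ t ∈ I, s ≤ t → hypLength Δ γ s t = hypDist Δ (γ s) (γ t)

/-- The hyperbolic distance `k_Δ(w, A) = inf_{a ∈ A} k_Δ(w, a)` from a point to a set. -/
def hypInfDist (Δ : Set ℂ) (w : ℂ) (A : Set ℂ) : ℝ :=
  sInf (hypDist Δ w '' A)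

/-- The hyperbolic sector `S_Δ(γ, R)` around `γ : [0, +∞) → Δ` of amplitude `R`. -/
def sector (Δ : Set ℂ) (γ : ℝ → ℂ) (R : ℝ) : Set ℂ :=
  {w | w ∈ Δ ∧ hypInfDist Δ w (γ '' Ici 0) < R}

/-- The sequence `z` has no accumulation points in `Δ`. -/
def CompactlyDivergent (Δ : Set ℂ) (z : ℕ → ℂ) : Prop :=
  ∀ w ∈ Δ, ¬ MapClusterPt w atTop z

/-- The sequence `ζ` converges to `σ` and is eventually contained in a Stolz region
`{ζ ∈ 𝔻 : |σ - ζ| < M (1 - |ζ|)}`, `M > 1`, of vertex `σ`. -/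
def ConvergesNonTangentially (ζ : ℕ → ℂ) (σ : ℂ) : Prop :=
  Tendsto ζ atTop (𝓝 σ) ∧
    ∃ M : ℝ, 1 < M ∧ ∀ᶠ n in atTop, ζ n ∈ Metric.ball (0 : ℂ) 1 ∧ ‖σ - ζ n‖ < M * (1 - ‖ζ n‖)

end HypSector

end

/-!
If `f⁻¹(z_n)` stays in a Stolz region of vertex `σ`, take `U = Δ` and the hyperbolic geodesic
`γ(t) = f(σ tanh t)`: a point of the Stolz region is at bounded hyperbolic distance from the point
of the radius towards `σ` with the same modulus.

Conversely, a hyperbolic disc of `U` of fixed radius centred on `γ` is contained in the sector,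
hence in `Δ`, and the Schwarz lemma on it gives `κ_U ≤ κ_Δ ≤ C κ_U` along `γ`. So `f⁻¹ ∘ γ` is a
quasi-geodesic ray of the disc. Since the projection to a diameter contracts exponentially in the
distance to the diameter, such a ray stays in a Stolz region of its limit point; the points
`f⁻¹(z_n)` lie at bounded hyperbolic distance from it, hence in a larger Stolz region.
-/

namespace HypSector

open scoped ComplexConjugate
open MeasureTheory Metric

/-! ### Injective holomorphic functions -/

theorem not_eventually_eq_of_injOn {X Y : Type*} [TopologicalSpace X] {f : X → Y} {s : Set X}
    {x : X} [(𝓝[≠] x).NeBot] (hs : s ∈ 𝓝 x) (hinj : InjOn f s) : ¬ ∀ᶠ y in 𝓝 x, f y = f x := by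
  intro hconst
  have heq : ∀ᶠ y in 𝓝[≠] x, y = x := by
    filter_upwards [hconst.filter_mono nhdsWithin_le_nhds, nhdsWithin_le_nhds hs] with y hy hys
    exact hinj hys (mem_of_mem_nhds hs) hy
  obtain ⟨y, hyx, hne⟩ := (heq.and eventually_mem_nhdsWithin).exists
  exact hne hyx

section Injective

variable {f : ℂ → ℂ} {s : Set ℂ} {z : ℂ}

theorem nhds_le_map_nhds_of_injOn (hs : IsOpen s) (hf : DifferentiableOn ℂ f s)
    (hinj : InjOn f s) (hz : z ∈ s) : 𝓝 (f z) ≤ map f (𝓝 z) :=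
  ((hf.analyticAt (hs.mem_nhds hz)).eventually_constant_or_nhds_le_map_nhds).resolve_left
    (not_eventually_eq_of_injOn (hs.mem_nhds hz) hinj)

theorem continuousAt_invFunOn (hs : IsOpen s) (hf : DifferentiableOn ℂ f s) (hinj : InjOn f s)
    (hz : z ∈ s) : ContinuousAt (Function.invFunOn f s) (f z) := by
  have hlim : Tendsto (Function.invFunOn f s) (map f (𝓝 z)) (𝓝 z) := by
    rw [tendsto_map'_iff]
    refine tendsto_id.congr' ?_
    filter_upwards [hs.mem_nhds hz] with w hw
    exact (hinj.leftInvOn_invFunOn hw).symm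
  rw [ContinuousAt, hinj.leftInvOn_invFunOn hz]
  exact hlim.mono_left (nhds_le_map_nhds_of_injOn hs hf hinj hz)

theorem eventually_apply_invFunOn (hs : IsOpen s) (hf : DifferentiableOn ℂ f s)
    (hinj : InjOn f s) (hz : z ∈ s) : ∀ᶠ w in 𝓝 (f z), f (Function.invFunOn f s w) = w := by
  refine nhds_le_map_nhds_of_injOn hs hf hinj hz (mem_map.2 ?_)
  filter_upwards [hs.mem_nhds hz] with w hw
  rw [mem_preimage, mem_ofPred_eq, hinj.leftInvOn_invFunOn hw]

theorem hasDerivAt_invFunOn_of_deriv_ne_zero (hs : IsOpen s) (hf : DifferentiableOn ℂ f s)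
    (hinj : InjOn f s) (hz : z ∈ s) (hd : deriv f z ≠ 0) :
    HasDerivAt (Function.invFunOn f s) (deriv f z)⁻¹ (f z) := by
  refine HasDerivAt.of_local_left_inverse (continuousAt_invFunOn hs hf hinj hz) ?_ hd
    (eventually_apply_invFunOn hs hf hinj hz)
  rw [hinj.leftInvOn_invFunOn hz]
  exact (hf.differentiableAt (hs.mem_nhds hz)).hasDerivAt

theorem eventually_deriv_ne_zero_of_injOn (hs : IsOpen s) (hf : DifferentiableOn ℂ f s)
    (hinj : InjOn f s) (hz : z ∈ s) : ∀ᶠ w in 𝓝[≠] z, deriv f w ≠ 0 := by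
  refine (hf.analyticAt
    (hs.mem_nhds hz)).deriv.eventually_eq_zero_or_eventually_ne_zero.resolve_left fun hzero => ?_
  obtain ⟨r, hr, hball⟩ := eventually_nhds_iff_ball.1 (hzero.and (hs.mem_nhds hz))
  refine not_eventually_eq_of_injOn (hs.mem_nhds hz) hinj ?_
  filter_upwards [ball_mem_nhds z hr] with w hw
  exact isOpen_ball.is_const_of_deriv_eq_zero (convex_ball z r).isPreconnected
    (hf.mono fun w hw => (hball w hw).2) (fun w hw => (hball w hw).1) hw (mem_ball_self hr)

/-- The inverse is holomorphic off the isolated critical values and continuous, so by Riemann's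
theorem on removable singularities it is holomorphic. -/
theorem differentiableAt_invFunOn (hs : IsOpen s) (hf : DifferentiableOn ℂ f s)
    (hinj : InjOn f s) (hz : z ∈ s) : DifferentiableAt ℂ (Function.invFunOn f s) (f z) := by
  refine (Complex.analyticAt_of_differentiable_on_punctured_nhds_of_continuousAt
    (eventually_nhdsWithin_iff.2 (nhds_le_map_nhds_of_injOn hs hf hinj hz (mem_map.2 ?_)))
    (continuousAt_invFunOn hs hf hinj hz)).differentiableAt
  filter_upwards [eventually_nhdsWithin_iff.1 (eventually_deriv_ne_zero_of_injOn hs hf hinj hz),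
    hs.mem_nhds hz] with w hd hw hne
  exact (hasDerivAt_invFunOn_of_deriv_ne_zero hs hf hinj hw
    (hd fun h => hne (congrArg f h))).differentiableAt

theorem deriv_ne_zero_of_injOn (hs : IsOpen s) (hf : DifferentiableOn ℂ f s) (hinj : InjOn f s)
    (hz : z ∈ s) : deriv f z ≠ 0 := by
  intro hzero
  have hcomp := (differentiableAt_invFunOn hs hf hinj hz).hasDerivAt.comp z
    (hf.differentiableAt (hs.mem_nhds hz)).hasDerivAt
  have hid : HasDerivAt (Function.invFunOn f s ∘ f) 1 z := by
    refine (hasDerivAt_id z).congr_of_eventuallyEq ?_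
    filter_upwards [hs.mem_nhds hz] with w hw
    exact hinj.leftInvOn_invFunOn hw
  exact zero_ne_one (by simpa only [hzero, mul_zero] using hcomp.unique hid)

theorem hasDerivAt_invFunOn (hs : IsOpen s) (hf : DifferentiableOn ℂ f s) (hinj : InjOn f s)
    (hz : z ∈ s) : HasDerivAt (Function.invFunOn f s) (deriv f z)⁻¹ (f z) :=
  hasDerivAt_invFunOn_of_deriv_ne_zero hs hf hinj hz (deriv_ne_zero_of_injOn hs hf hinj hz)

end Injective

/-! ### Riemann maps and the Schwarz lemma -/

/-- The inverse of a Riemann map `f`, that is, the coordinate in the unit disc that `f` induces on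
its image; arbitrary values are taken off that image. -/
noncomputable def riemannInv (f : ℂ → ℂ) : ℂ → ℂ := Function.invFunOn f (ball 0 1)

namespace IsRiemannMap

variable {f g : ℂ → ℂ} {U : Set ℂ} {z w : ℂ}

theorem mem (hf : IsRiemannMap f U) (hz : ‖z‖ < 1) : f z ∈ U :=
  hf.2.mapsTo (mem_ball_zero_iff.2 hz)

theorem apply_zero_mem (hf : IsRiemannMap f U) : f 0 ∈ U :=
  hf.2.mapsTo (mem_ball_self one_pos)

theorem riemannInv_apply (hf : IsRiemannMap f U) (hz : ‖z‖ < 1) : riemannInv f (f z) = z :=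
  hf.2.injOn.leftInvOn_invFunOn (mem_ball_zero_iff.2 hz)

theorem riemannInv_apply_zero (hf : IsRiemannMap f U) : riemannInv f (f 0) = 0 :=
  hf.2.injOn.leftInvOn_invFunOn (mem_ball_self one_pos)

theorem norm_riemannInv_lt (hf : IsRiemannMap f U) (hw : w ∈ U) : ‖riemannInv f w‖ < 1 :=
  mem_ball_zero_iff.1 (Function.invFunOn_mem (hf.2.surjOn hw))

theorem apply_riemannInv (hf : IsRiemannMap f U) (hw : w ∈ U) : f (riemannInv f w) = w :=
  Function.invFunOn_eq (hf.2.surjOn hw)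

theorem differentiableAt (hf : IsRiemannMap f U) (hz : ‖z‖ < 1) : DifferentiableAt ℂ f z :=
  hf.1.differentiableAt (isOpen_ball.mem_nhds (mem_ball_zero_iff.2 hz))

theorem deriv_ne_zero (hf : IsRiemannMap f U) (hz : ‖z‖ < 1) : deriv f z ≠ 0 :=
  deriv_ne_zero_of_injOn isOpen_ball hf.1 hf.2.injOn (mem_ball_zero_iff.2 hz)

theorem hasDerivAt_riemannInv (hf : IsRiemannMap f U) (hw : w ∈ U) :
    HasDerivAt (riemannInv f) (deriv f (riemannInv f w))⁻¹ w := by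
  have hd := hasDerivAt_invFunOn isOpen_ball hf.1 hf.2.injOn
    (mem_ball_zero_iff.2 (hf.norm_riemannInv_lt hw))
  rwa [hf.apply_riemannInv hw] at hd

theorem isOpen (hf : IsRiemannMap f U) : IsOpen U := by
  refine isOpen_iff_mem_nhds.2 fun w hw => ?_
  have hmem : riemannInv f w ∈ ball (0 : ℂ) 1 := mem_ball_zero_iff.2 (hf.norm_riemannInv_lt hw)
  rw [← hf.apply_riemannInv hw, ← hf.2.image_eq]
  exact nhds_le_map_nhds_of_injOn isOpen_ball hf.1 hf.2.injOn hmem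
    (image_mem_map (isOpen_ball.mem_nhds hmem))

theorem differentiableOn_riemannInv (hf : IsRiemannMap f U) :
    DifferentiableOn ℂ (riemannInv f) U := fun _ hw =>
  (hf.hasDerivAt_riemannInv hw).differentiableAt.differentiableWithinAt

theorem comp (hf : IsRiemannMap f U) {φ ψ : ℂ → ℂ} (hφ : DifferentiableOn ℂ φ (ball 0 1))
    (hφm : MapsTo φ (ball 0 1) (ball 0 1)) (hψm : MapsTo ψ (ball 0 1) (ball 0 1))
    (hinv : InvOn ψ φ (ball 0 1) (ball 0 1)) : IsRiemannMap (f ∘ φ) U :=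
  ⟨hf.1.comp hφ hφm, hf.2.comp (hinv.bijOn hφm hψm)⟩

theorem mapsTo_closedBall_riemannInv_comp (hf : IsRiemannMap f U) {s : Set ℂ}
    (hgf : g 0 = f 0) (hm : MapsTo g s U) :
    MapsTo (riemannInv f ∘ g) s (closedBall ((riemannInv f ∘ g) 0) 1) := fun w hw => by
  rw [Function.comp_apply, Function.comp_apply, hgf, hf.riemannInv_apply_zero,
    mem_closedBall_zero_iff]
  exact (hf.norm_riemannInv_lt (hm hw)).le

theorem norm_riemannInv_le_of_mapsTo (hf : IsRiemannMap f U) {r : ℝ}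
    (hg : DifferentiableOn ℂ g (ball 0 r)) (hgf : g 0 = f 0) (hm : MapsTo g (ball 0 r) U)
    (hw : ‖w‖ < r) : ‖riemannInv f (g w)‖ ≤ ‖w‖ / r := by
  have hschwarz := Complex.dist_le_div_mul_dist_of_mapsTo_ball
    (hf.differentiableOn_riemannInv.comp hg hm) (hf.mapsTo_closedBall_riemannInv_comp hgf hm)
    (mem_ball_zero_iff.2 hw)
  simp only [Function.comp_apply, hgf, hf.riemannInv_apply_zero, dist_zero_right] at hschwarz
  rwa [one_div, inv_mul_eq_div] at hschwarz

theorem norm_deriv_le_of_mapsTo (hf : IsRiemannMap f U) {r : ℝ} (hr : 0 < r)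
    (hg : DifferentiableOn ℂ g (ball 0 r)) (hgf : g 0 = f 0) (hm : MapsTo g (ball 0 r) U) :
    ‖deriv g 0‖ ≤ ‖deriv f 0‖ / r := by
  have hinv : HasDerivAt (riemannInv f) (deriv f 0)⁻¹ (g 0) := by
    have hd := hf.hasDerivAt_riemannInv hf.apply_zero_mem
    rwa [hf.riemannInv_apply_zero, ← hgf] at hd
  have hcomp : HasDerivAt (riemannInv f ∘ g) ((deriv f 0)⁻¹ * deriv g 0) 0 :=
    hinv.comp 0 (hg.differentiableAt (ball_mem_nhds 0 hr)).hasDerivAt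
  have hschwarz := Complex.norm_deriv_le_div_of_mapsTo_ball
    (hf.differentiableOn_riemannInv.comp hg hm) (hf.mapsTo_closedBall_riemannInv_comp hgf hm) hr
  have hpos : 0 < ‖deriv f 0‖ := norm_pos_iff.2 (hf.deriv_ne_zero (by simp))
  rwa [hcomp.deriv, norm_mul, norm_inv, inv_mul_le_iff₀ hpos, mul_one_div] at hschwarz

theorem norm_deriv_eq_of_apply_zero_eq (hf : IsRiemannMap f U) (hg : IsRiemannMap g U)
    (h : f 0 = g 0) : ‖deriv f 0‖ = ‖deriv g 0‖ := by
  have hle : ∀ {f g : ℂ → ℂ}, IsRiemannMap f U → IsRiemannMap g U → f 0 = g 0 →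
      ‖deriv f 0‖ ≤ ‖deriv g 0‖ := fun hf hg h => by
    simpa only [div_one] using hg.norm_deriv_le_of_mapsTo one_pos hf.1 h hf.2.mapsTo
  exact le_antisymm (hle hf hg h) (hle hg hf h.symm)

end IsRiemannMap

/-! ### Automorphisms of the disc -/

/-- The automorphism of the unit disc that moves `0` to `a` and has positive derivative at `0`. -/
noncomputable def discAut (a w : ℂ) : ℂ := (w + a) / (1 + conj a * w)

section DiscAut

variable {a w z : ℂ}

theorem one_add_conj_mul_ne_zero (ha : ‖a‖ < 1) (hw : ‖w‖ ≤ 1) : 1 + conj a * w ≠ 0 := by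
  intro h
  have hnorm : ‖a‖ * ‖w‖ = 1 := by
    simpa using congrArg norm (eq_neg_of_add_eq_zero_right h)
  exact (mul_lt_one_of_nonneg_of_lt_one_left (norm_nonneg a) ha hw).ne hnorm

theorem one_sub_norm_sq_pos (hw : ‖w‖ < 1) : 0 < 1 - ‖w‖ ^ 2 :=
  sub_pos.2 (pow_lt_one₀ (norm_nonneg w) hw two_ne_zero)

theorem sq_norm_one_add_conj_mul (a w : ℂ) :
    ‖1 + conj a * w‖ ^ 2 = ‖w + a‖ ^ 2 + (1 - ‖a‖ ^ 2) * (1 - ‖w‖ ^ 2) := by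
  simp only [← Complex.normSq_eq_norm_sq, Complex.normSq_apply, Complex.add_re, Complex.add_im,
    Complex.mul_re, Complex.mul_im, Complex.conj_re, Complex.conj_im, Complex.one_re,
    Complex.one_im]
  ring

theorem one_sub_sq_norm_discAut (ha : ‖a‖ < 1) (hw : ‖w‖ ≤ 1) :
    1 - ‖discAut a w‖ ^ 2 = (1 - ‖a‖ ^ 2) * (1 - ‖w‖ ^ 2) / ‖1 + conj a * w‖ ^ 2 := by
  have hden := norm_pos_iff.2 (one_add_conj_mul_ne_zero ha hw)
  rw [discAut, norm_div, div_pow, one_sub_div (by positivity), sq_norm_one_add_conj_mul,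
    add_sub_cancel_left]

theorem norm_discAut_lt_one (ha : ‖a‖ < 1) (hw : ‖w‖ < 1) : ‖discAut a w‖ < 1 := by
  have hpos : 0 < 1 - ‖discAut a w‖ ^ 2 := by
    rw [one_sub_sq_norm_discAut ha hw.le]
    exact div_pos (mul_pos (one_sub_norm_sq_pos ha) (one_sub_norm_sq_pos hw))
      (pow_pos (norm_pos_iff.2 (one_add_conj_mul_ne_zero ha hw.le)) 2)
  exact (sq_lt_one_iff₀ (norm_nonneg _)).1 (sub_pos.1 hpos)

theorem discAut_zero (a : ℂ) : discAut a 0 = a := by simp [discAut]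

theorem discAut_neg_self (a : ℂ) : discAut (-a) a = 0 := by simp [discAut]

theorem norm_one_sub_conj_mul_self (ha : ‖a‖ < 1) : ‖(1 : ℂ) - conj a * a‖ = 1 - ‖a‖ ^ 2 := by
  rw [Complex.conj_mul', ← Complex.ofReal_pow, ← Complex.ofReal_one, ← Complex.ofReal_sub,
    Complex.norm_real, Real.norm_of_nonneg (one_sub_norm_sq_pos ha).le]

theorem discAut_neg_discAut (ha : ‖a‖ < 1) (hw : ‖w‖ ≤ 1) : discAut (-a) (discAut a w) = w := by
  have hden := one_add_conj_mul_ne_zero ha hw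
  have hconst : (1 : ℂ) - conj a * a ≠ 0 := by
    rw [← norm_ne_zero_iff, norm_one_sub_conj_mul_self ha]
    exact (one_sub_norm_sq_pos ha).ne'
  have hnum : discAut a w - a = (1 - conj a * a) * w / (1 + conj a * w) := by
    rw [discAut, div_sub' hden]; congr 1; ring
  have hden' : 1 - conj a * discAut a w = (1 - conj a * a) / (1 + conj a * w) := by
    rw [discAut, mul_div_assoc', one_sub_div hden]; congr 1; ring
  rw [discAut, map_neg, ← sub_eq_add_neg, neg_mul, ← sub_eq_add_neg, hnum, hden']
  field_simp

theorem discAut_discAut_neg (ha : ‖a‖ < 1) (hw : ‖w‖ ≤ 1) : discAut a (discAut (-a) w) = w := by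
  simpa only [neg_neg] using discAut_neg_discAut (a := -a) (by rwa [norm_neg]) hw

theorem hasDerivAt_discAut (ha : ‖a‖ < 1) (hw : ‖w‖ ≤ 1) :
    HasDerivAt (discAut a) ((1 - conj a * a) / (1 + conj a * w) ^ 2) w := by
  have hquot := ((hasDerivAt_id w).add_const a).div
    (((hasDerivAt_id w).const_mul (conj a)).const_add 1) (one_add_conj_mul_ne_zero ha hw)
  refine hquot.congr_deriv ?_
  simp only [id]
  ring

theorem differentiableOn_discAut (ha : ‖a‖ < 1) : DifferentiableOn ℂ (discAut a) (ball 0 1) :=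
  fun _ hw => (hasDerivAt_discAut ha
    (mem_ball_zero_iff.1 hw).le).differentiableAt.differentiableWithinAt

theorem mapsTo_discAut (ha : ‖a‖ < 1) : MapsTo (discAut a) (ball 0 1) (ball 0 1) := fun _ hw =>
  mem_ball_zero_iff.2 (norm_discAut_lt_one ha (mem_ball_zero_iff.1 hw))

theorem invOn_discAut (ha : ‖a‖ < 1) :
    InvOn (discAut (-a)) (discAut a) (ball 0 1) (ball 0 1) :=
  ⟨fun _ hw => discAut_neg_discAut ha (mem_ball_zero_iff.1 hw).le,
    fun _ hw => discAut_discAut_neg ha (mem_ball_zero_iff.1 hw).le⟩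

theorem norm_deriv_discAut (ha : ‖a‖ < 1) (hw : ‖w‖ < 1) :
    ‖deriv (discAut a) w‖ = (1 - ‖discAut a w‖ ^ 2) / (1 - ‖w‖ ^ 2) := by
  rw [(hasDerivAt_discAut ha hw.le).deriv, one_sub_sq_norm_discAut ha hw.le, norm_div, norm_pow,
    norm_one_sub_conj_mul_self ha, div_right_comm,
    mul_div_cancel_right₀ _ (one_sub_norm_sq_pos hw).ne']

theorem discAut_sub_discAut (ha : ‖a‖ < 1) (hw : ‖w‖ ≤ 1) (hz : ‖z‖ ≤ 1) :
    discAut a w - discAut a z =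
      (1 - conj a * a) * (w - z) / ((1 + conj a * w) * (1 + conj a * z)) := by
  rw [discAut, discAut, div_sub_div _ _ (one_add_conj_mul_ne_zero ha hw)
    (one_add_conj_mul_ne_zero ha hz)]
  congr 1; ring

end DiscAut

/-! ### The hyperbolic metric in the coordinate of a Riemann map -/

namespace IsRiemannMap

variable {f : ℂ → ℂ} {U : Set ℂ} {a : ℂ}

theorem comp_discAut (hf : IsRiemannMap f U) (ha : ‖a‖ < 1) : IsRiemannMap (f ∘ discAut a) U :=
  hf.comp (differentiableOn_discAut ha) (mapsTo_discAut ha)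
    (mapsTo_discAut (by rwa [norm_neg])) (invOn_discAut ha)

theorem norm_deriv_comp_discAut (hf : IsRiemannMap f U) (ha : ‖a‖ < 1) :
    ‖deriv (f ∘ discAut a) 0‖ = ‖deriv f a‖ * (1 - ‖a‖ ^ 2) := by
  have haut : HasDerivAt (discAut a) (1 - conj a * a) 0 := by
    simpa using hasDerivAt_discAut ha (w := 0) (by simp)
  have hd := (hf.differentiableAt ha).hasDerivAt.comp_of_eq 0 haut (discAut_zero a).symm
  rw [hd.deriv, norm_mul, norm_one_sub_conj_mul_self ha]

theorem comp_rotation (hf : IsRiemannMap f U) {e : ℂ} (he : ‖e‖ = 1) :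
    IsRiemannMap (f ∘ fun z => e * z) U := by
  have he0 : e ≠ 0 := norm_ne_zero_iff.1 (he ▸ one_ne_zero)
  refine hf.comp (ψ := fun z => e⁻¹ * z) (by fun_prop) (fun z hz => ?_) (fun z hz => ?_)
    ⟨fun z _ => inv_mul_cancel_left₀ he0 z, fun z _ => mul_inv_cancel_left₀ he0 z⟩
  · simpa [he] using hz
  · simpa [he] using hz

theorem exists_deriv_eq_norm (hf : IsRiemannMap f U) :
    ∃ g, IsRiemannMap g U ∧ g 0 = f 0 ∧ deriv g 0 = ‖deriv f 0‖ := by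
  obtain ⟨e, he, hnorm⟩ := RCLike.exists_norm_eq_mul_self (deriv f 0)
  refine ⟨f ∘ fun z => e * z, hf.comp_rotation he, by simp, ?_⟩
  have hd : HasDerivAt (f ∘ fun z => e * z) (deriv f 0 * e) 0 :=
    (hf.differentiableAt (by simp)).hasDerivAt.comp_of_eq 0
      (by simpa using (hasDerivAt_id (0 : ℂ)).const_mul e) (mul_zero e).symm
  rw [hd.deriv, mul_comm]
  exact hnorm.symm

theorem kappa_apply_zero (hf : IsRiemannMap f U) (v : ℂ) :
    kappa U (f 0) v = ‖v‖ / ‖deriv f 0‖ := by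
  suffices h : {r : ℝ | ∃ g : ℂ → ℂ, IsRiemannMap g U ∧ g 0 = f 0 ∧ 0 < (deriv g 0).re ∧
      (deriv g 0).im = 0 ∧ r = ‖v‖ / (deriv g 0).re} = {‖v‖ / ‖deriv f 0‖} by
    rw [kappa, h, csInf_singleton]
  refine Subset.antisymm ?_ (singleton_subset_iff.2 ?_)
  · rintro r ⟨g, hg, hgf, hre, him, rfl⟩
    have hreal : deriv g 0 = (deriv g 0).re := Complex.ext rfl him
    rw [mem_singleton_iff, ← hg.norm_deriv_eq_of_apply_zero_eq hf hgf, hreal, Complex.norm_real,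
      Real.norm_of_nonneg hre.le, Complex.ofReal_re]
  · obtain ⟨g, hg, hgf, hd⟩ := hf.exists_deriv_eq_norm
    have hpos : 0 < ‖deriv f 0‖ := norm_pos_iff.2 (hf.deriv_ne_zero (by simp))
    exact ⟨g, hg, hgf, by rwa [hd, Complex.ofReal_re], by rw [hd, Complex.ofReal_im],
      by rw [hd, Complex.ofReal_re]⟩

theorem kappa_apply (hf : IsRiemannMap f U) (ha : ‖a‖ < 1) (v : ℂ) :
    kappa U (f a) v = ‖v‖ / (‖deriv f a‖ * (1 - ‖a‖ ^ 2)) := by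
  have hzero := (hf.comp_discAut ha).kappa_apply_zero v
  rwa [Function.comp_apply, discAut_zero, hf.norm_deriv_comp_discAut ha] at hzero

theorem kappa_eq (hf : IsRiemannMap f U) {w : ℂ} (hw : w ∈ U) (v : ℂ) :
    kappa U w v = ‖v‖ / (‖deriv f (riemannInv f w)‖ * (1 - ‖riemannInv f w‖ ^ 2)) := by
  simpa only [hf.apply_riemannInv hw] using hf.kappa_apply (hf.norm_riemannInv_lt hw) v

end IsRiemannMap

theorem kappa_nonneg (U : Set ℂ) (z v : ℂ) : 0 ≤ kappa U z v := by
  refine Real.sInf_nonneg ?_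
  rintro r ⟨g, -, -, hre, -, rfl⟩
  positivity

/-! ### The Riemann mapping theorem -/

theorem mapsTo_closedBall_two_mul {X E : Type*} [SeminormedAddCommGroup E] {f : X → E} {s : Set X}
    {M : ℝ} (hf : MapsTo f s (closedBall 0 M)) {x : X} (hx : x ∈ s) :
    MapsTo f s (closedBall (f x) (2 * M)) := fun y hy => by
  rw [two_mul, mem_closedBall]
  exact (dist_triangle_right _ _ _).trans (add_le_add (hf hy) (hf hx))

section NormalFamilies

variable {ι : Type*} {F : ι → ℂ → ℂ} {f : ℂ → ℂ} {U : Set ℂ} {M : ℝ} {b : ℂ}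

theorem equicontinuousAt_of_mapsTo_closedBall (hU : IsOpen U)
    (hF : ∀ i, DifferentiableOn ℂ (F i) U) (hM : ∀ i, MapsTo (F i) U (closedBall 0 M))
    (hb : b ∈ U) : EquicontinuousAt F b := by
  obtain ⟨r, hr, hball⟩ := Metric.isOpen_iff.1 hU b hb
  refine equicontinuousAt_of_continuity_modulus (fun z => 2 * M / r * dist z b) ?_ F ?_
  · have hcont : Continuous fun z => 2 * M / r * dist z b := by fun_prop
    simpa using hcont.tendsto b
  · filter_upwards [ball_mem_nhds b hr] with z hz i
    rw [dist_comm]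
    exact Complex.dist_le_div_mul_dist_of_mapsTo_ball ((hF i).mono hball)
      ((mapsTo_closedBall_two_mul (hM i) hb).mono_left hball) hz

/-- Montel's theorem, in the form that avoids extracting subsequences: along an ultrafilter the
pointwise limits exist, and by Ascoli the convergence is locally uniform. -/
theorem exists_tendstoLocallyUniformlyOn (hU : IsOpen U) (hF : ∀ i, DifferentiableOn ℂ (F i) U)
    (hM : ∀ i, MapsTo (F i) U (closedBall 0 M)) (𝒰 : Ultrafilter ι) :
    ∃ f : ℂ → ℂ, TendstoLocallyUniformlyOn F f 𝒰 U := by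
  have hlim : ∀ z ∈ U, ∃ y, Tendsto (fun i => F i z) 𝒰 (𝓝 y) := fun z hz => by
    obtain ⟨y, -, hy⟩ := (isCompact_closedBall (0 : ℂ) M).ultrafilter_le_nhds'
      (𝒰.map fun i => F i z)
      (Ultrafilter.mem_map.2 (Eventually.of_forall fun i => hM i hz))
    exact ⟨y, hy⟩
  choose! f hf using hlim
  refine ⟨f, (tendstoLocallyUniformlyOn_iff_forall_isCompact hU).2 fun K hKU hK => ?_⟩
  have hpi : Tendsto ((⋃₀ {K}).domRestrict ∘ F) 𝒰 (𝓝 ((⋃₀ {K}).domRestrict f)) :=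
    tendsto_pi_nhds.2 fun z => hf z (hKU (by simpa using z.2))
  have heq : ∀ L ∈ ({K} : Set (Set ℂ)), EquicontinuousOn F L := by
    rintro _ rfl z hz
    exact (equicontinuousAt_of_mapsTo_closedBall hU hF hM (hKU hz)).equicontinuousWithinAt _
  have hunif := (EquicontinuousOn.tendsto_uniformOnFun_iff_pi'
    (by rintro _ rfl; exact hK) heq 𝒰 f).2 hpi
  exact UniformOnFun.tendsto_iff_tendstoUniformlyOn.1 hunif K rfl

/-- The local form of Hurwitz's theorem: a value of the limit is eventually attained nearby. -/
theorem exists_eventually_ball_subset_image {l : Filter ι} (hU : IsOpen U)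
    (hlim : TendstoLocallyUniformlyOn F f l U) (hF : ∀ i, DifferentiableOn ℂ (F i) U)
    (hFb : ∀ i, ∃ᶠ z in 𝓝 b, F i z ≠ F i b) (hf : ContinuousOn f U)
    (hfb : ∀ᶠ z in 𝓝[≠] b, f z ≠ f b) {V : Set ℂ} (hV : V ∈ 𝓝 b) (hVU : V ⊆ U) :
    ∃ ε > 0, ∀ᶠ i in l, ball (f b) ε ⊆ F i '' V := by
  obtain ⟨r, hr, hball⟩ := nhds_basis_closedBall.eventually_iff.1
    ((eventually_nhdsWithin_iff.1 hfb).and hV)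
  have hrU : closedBall b r ⊆ U := fun z hz => hVU (hball hz).2
  obtain ⟨m, hm, hmin⟩ := (isCompact_sphere b r).exists_isMinOn
    (NormedSpace.sphere_nonempty.2 hr.le) (f := fun z => ‖f z - f b‖)
    ((hf.mono (sphere_subset_closedBall.trans hrU)).sub continuousOn_const).norm
  have hε : 0 < ‖f m - f b‖ := norm_pos_iff.2 (sub_ne_zero.2
    ((hball (sphere_subset_closedBall hm)).1 (ne_of_mem_sphere hm hr.ne')))
  set ε := ‖f m - f b‖
  refine ⟨ε / 8, by positivity, ?_⟩
  filter_upwards [Metric.tendstoUniformlyOn_iff.1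
    ((tendstoLocallyUniformlyOn_iff_forall_isCompact hU).1 hlim _ hrU (isCompact_closedBall b r))
    (ε / 8) (by positivity)] with i hi
  have hib := hi b (mem_closedBall_self hr.le)
  have hsphere : ∀ z ∈ sphere b r, ε / 2 ≤ ‖F i z - F i b‖ := fun z hz => by
    have hmz : ε ≤ ‖f z - f b‖ := hmin hz
    have hiz := hi z (sphere_subset_closedBall hz)
    have htri := dist_triangle4 (f z) (F i z) (F i b) (f b)
    rw [dist_comm (F i b)] at htri
    rw [← dist_eq_norm] at hmz ⊢
    linarith
  have hsub := ((hF i).diffContOnCl_ball hrU).ball_subset_image_closedBall hr hsphere (hFb i)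
  refine (ball_subset_ball' ?_).trans (hsub.trans (image_mono fun z hz => (hball hz).2))
  linarith

theorem eventually_ne_of_deriv_ne_zero (hU : IsOpen U) (hUc : IsPreconnected U)
    (hf : DifferentiableOn ℂ f U) {z₀ : ℂ} (hz₀ : z₀ ∈ U) (hd : deriv f z₀ ≠ 0) (hb : b ∈ U) :
    ∀ᶠ z in 𝓝[≠] b, f z ≠ f b := by
  refine ((hf.analyticAt (hU.mem_nhds hb)).eventually_eq_or_eventually_ne
    analyticAt_const).resolve_left fun hconst => hd ?_
  have heqOn := (hf.analyticOnNhd hU).eqOn_of_preconnected_of_eventuallyEq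
    (analyticOnNhd_const (v := f b)) hUc hb hconst
  rw [(heqOn.eventuallyEq_of_mem (hU.mem_nhds hz₀)).deriv_eq, deriv_const]

theorem injOn_of_tendstoLocallyUniformlyOn {l : Filter ι} [l.NeBot] (hU : IsOpen U)
    (hUc : IsPreconnected U) (hlim : TendstoLocallyUniformlyOn F f l U)
    (hF : ∀ i, DifferentiableOn ℂ (F i) U) (hinj : ∀ i, InjOn (F i) U) {z₀ : ℂ} (hz₀ : z₀ ∈ U)
    (hd : deriv f z₀ ≠ 0) : InjOn f U := by
  have hf : DifferentiableOn ℂ f U := hlim.differentiableOn (Eventually.of_forall hF) hU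
  intro a ha b hb hab
  by_contra hne
  obtain ⟨ε, hε, himage⟩ := exists_eventually_ball_subset_image hU hlim hF
    (fun i => not_eventually.1 (not_eventually_eq_of_injOn (hU.mem_nhds hb) (hinj i)))
    hf.continuousOn (eventually_ne_of_deriv_ne_zero hU hUc hf hz₀ hd hb)
    (inter_mem (hU.mem_nhds hb) (isOpen_ne.mem_nhds (Ne.symm hne))) inter_subset_left
  have hnear : ∀ᶠ i in l, F i a ∈ ball (f b) ε :=
    hab ▸ (hlim.tendsto_at ha).eventually_mem (ball_mem_nhds _ hε)
  obtain ⟨i, hsub, hi⟩ := (himage.and hnear).exists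
  obtain ⟨w, ⟨hwU, hwa⟩, hw⟩ := hsub hi
  exact hwa (hinj i hwU ha hw)

end NormalFamilies

/-- Holomorphic embeddings of `U` into the unit disc, the competitors in the extremal problem
that produces the Riemann map. -/
structure IsDiscEmbedding (f : ℂ → ℂ) (U : Set ℂ) : Prop where
  differentiableOn : DifferentiableOn ℂ f U
  injOn : InjOn f U
  mapsTo : MapsTo f U (ball 0 1)

section DiscEmbedding

variable {f : ℂ → ℂ} {U : Set ℂ} {a z z₀ : ℂ}

theorem exists_differentiableOn_sq_eq (hU : IsOpen U) (hUc : IsSimplyConnected U)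
    (hf : DifferentiableOn ℂ f U) (h0 : ∀ z ∈ U, f z ≠ 0) :
    ∃ h : ℂ → ℂ, DifferentiableOn ℂ h U ∧ ∀ z, h z ^ 2 = f z := by
  obtain ⟨h, hc, hsq⟩ := Complex.exists_continuousOn_pow_eq hUc hU hf.continuousOn
    (by rintro ⟨z, hz, hfz⟩; exact h0 z hz hfz) two_ne_zero
  refine ⟨h, fun z hz => ?_, hsq⟩
  have hne : h z ≠ 0 := fun hhz => h0 z hz (by rw [← hsq z, hhz, zero_pow two_ne_zero])
  exact (HasDerivAt.of_comp_left (hc.continuousAt (hU.mem_nhds hz)) (hasDerivAt_pow 2 (h z))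
    (hf.differentiableAt (hU.mem_nhds hz)).hasDerivAt (by simpa using hne)
    (Eventually.of_forall hsq)).differentiableAt.differentiableWithinAt

/-- The image of a branch of the square root is disjoint from its negative, and it is open. -/
theorem exists_forall_le_norm_add (hU : IsOpen U) (hf : DifferentiableOn ℂ f U) (hinj : InjOn f U)
    (hne : ∀ z ∈ U, ∀ w ∈ U, f z + f w ≠ 0) (hz₀ : z₀ ∈ U) :
    ∃ ε > 0, ∀ z ∈ U, ε ≤ ‖f z + f z₀‖ := by
  obtain ⟨ε, hε, hball⟩ := Metric.mem_nhds_iff.1 (nhds_le_map_nhds_of_injOn hU hf hinj hz₀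
    (image_mem_map (hU.mem_nhds hz₀)))
  refine ⟨ε, hε, fun z hz => le_of_not_gt fun hlt => ?_⟩
  obtain ⟨w, hw, hwz⟩ := hball (show -f z ∈ ball (f z₀) ε by
    rwa [mem_ball_iff_norm, ← neg_add', norm_neg])
  exact hne w hw z hz (by rw [hwz, neg_add_cancel])

theorem exists_isDiscEmbedding (hU : IsProperSCDomain U) : ∃ f, IsDiscEmbedding f U := by
  obtain ⟨a, ha⟩ := (ne_univ_iff_exists_notMem U).1 hU.2.2
  obtain ⟨h, hd, hsq⟩ := exists_differentiableOn_sq_eq hU.1 hU.2.1 (f := fun z => z - a)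
    (by fun_prop) fun z hz hza => ha (sub_eq_zero.1 hza ▸ hz)
  have hinj : ∀ z w, h z ^ 2 = h w ^ 2 → z = w := fun z w hzw => by
    rwa [hsq, hsq, sub_left_inj] at hzw
  have hne : ∀ z ∈ U, ∀ w ∈ U, h z + h w ≠ 0 := fun z hz w hw hzw => by
    obtain rfl := hinj z w (by rw [eq_neg_of_add_eq_zero_left hzw, neg_sq])
    have hza : z - a = 0 := by rw [← hsq, add_self_eq_zero.1 hzw, zero_pow two_ne_zero]
    exact ha (sub_eq_zero.1 hza ▸ hz)
  have hinjOn : InjOn h U := fun z _ w _ hzw => hinj z w (by rw [hzw])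
  obtain ⟨x, hx⟩ := hU.2.1.nonempty
  obtain ⟨ε, hε, hfar⟩ := exists_forall_le_norm_add hU.1 hd hinjOn hne hx
  refine ⟨fun z => (ε / 2 : ℝ) / (h z + h x), ?_, fun z hz w hw hzw => ?_, fun z hz => ?_⟩
  · exact (differentiableOn_const _).div (hd.add_const _) fun z hz => hne z hz x hx
  · have hε2 : ((ε / 2 : ℝ) : ℂ) ≠ 0 := Complex.ofReal_ne_zero.2 (by positivity)
    simp only [div_eq_mul_inv] at hzw
    exact hinjOn hz hw (add_right_cancel (inv_injective (mul_left_cancel₀ hε2 hzw)))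
  · rw [mem_ball_zero_iff, norm_div, Complex.norm_real, Real.norm_of_nonneg (by positivity),
      div_lt_one (hε.trans_le (hfar z hz))]
    exact (half_lt_self hε).trans_le (hfar z hz)

namespace IsDiscEmbedding

theorem norm_lt (hf : IsDiscEmbedding f U) (hz : z ∈ U) : ‖f z‖ < 1 :=
  mem_ball_zero_iff.1 (hf.mapsTo hz)

theorem discAut_comp (hf : IsDiscEmbedding f U) (ha : ‖a‖ < 1) :
    IsDiscEmbedding (discAut a ∘ f) U :=
  ⟨(differentiableOn_discAut ha).comp hf.differentiableOn hf.mapsTo,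
    (invOn_discAut ha).1.injOn.comp hf.injOn hf.mapsTo, (mapsTo_discAut ha).comp hf.mapsTo⟩

theorem hasDerivAt (hf : IsDiscEmbedding f U) (hU : IsOpen U) (hz : z ∈ U) :
    HasDerivAt f (deriv f z) z :=
  (hf.differentiableOn.differentiableAt (hU.mem_nhds hz)).hasDerivAt

theorem norm_deriv_pos (hf : IsDiscEmbedding f U) (hU : IsOpen U) (hz : z ∈ U) :
    0 < ‖deriv f z‖ :=
  norm_pos_iff.2 (deriv_ne_zero_of_injOn hU hf.differentiableOn hf.injOn hz)

theorem norm_deriv_discAut_comp (hf : IsDiscEmbedding f U) (hU : IsOpen U) (ha : ‖a‖ < 1)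
    (hz : z ∈ U) : ‖deriv (discAut a ∘ f) z‖ =
      (1 - ‖discAut a (f z)‖ ^ 2) / (1 - ‖f z‖ ^ 2) * ‖deriv f z‖ := by
  have haut := (hasDerivAt_discAut ha (hf.norm_lt hz).le).differentiableAt.hasDerivAt
  rw [(haut.comp z (hf.hasDerivAt hU hz)).deriv, norm_mul, norm_deriv_discAut ha (hf.norm_lt hz)]

theorem exists_sq_eq_discAut (hf : IsDiscEmbedding f U) (hU : IsOpen U)
    (hUc : IsSimplyConnected U) (ha : ‖a‖ < 1) (haU : a ∉ f '' U) :
    ∃ h, IsDiscEmbedding h U ∧ ∀ z, h z ^ 2 = discAut (-a) (f z) := by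
  have hφ := hf.discAut_comp (a := -a) (by rwa [norm_neg])
  obtain ⟨h, hd, hsq⟩ := exists_differentiableOn_sq_eq hU hUc hφ.differentiableOn
    fun z hz hzero => haU ⟨z, hz, by
      rw [← discAut_discAut_neg ha (hf.norm_lt hz).le, ← Function.comp_apply (f := discAut (-a)),
        hzero, discAut_zero]⟩
  refine ⟨h, ⟨hd, fun z hz w hw hzw => hφ.injOn hz hw (by rw [← hsq, ← hsq, hzw]),
    fun z hz => ?_⟩, hsq⟩
  have hlt := hφ.norm_lt hz
  rw [← hsq, norm_pow] at hlt
  exact mem_ball_zero_iff.2 ((sq_lt_one_iff₀ (norm_nonneg _)).1 hlt)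

/-- Koebe's square root trick. -/
theorem exists_norm_deriv_lt (hf : IsDiscEmbedding f U) (hU : IsOpen U)
    (hUc : IsSimplyConnected U) (hz₀ : z₀ ∈ U) (ha : ‖a‖ < 1) (haU : a ∉ f '' U) :
    ∃ k, IsDiscEmbedding k U ∧ ‖deriv f z₀‖ < ‖deriv k z₀‖ := by
  obtain ⟨h, hh, hsq⟩ := hf.exists_sq_eq_discAut hU hUc ha haU
  have hc : ‖-h z₀‖ < 1 := by simpa using hh.norm_lt hz₀
  refine ⟨_, hh.discAut_comp hc, ?_⟩
  have hderiv : 2 * ‖h z₀‖ * ‖deriv h z₀‖ =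
      (1 - (‖h z₀‖ ^ 2) ^ 2) / (1 - ‖f z₀‖ ^ 2) * ‖deriv f z₀‖ := by
    have hpow := (hh.hasDerivAt hU hz₀).pow 2
    have hnorm := hf.norm_deriv_discAut_comp hU (a := -a) (by rwa [norm_neg]) hz₀
    rw [← norm_pow, hsq, ← hnorm, ← show h ^ 2 = discAut (-a) ∘ f from funext hsq, hpow.deriv]
    simp
  rw [hh.norm_deriv_discAut_comp hU hc hz₀, discAut_neg_self, norm_zero, zero_pow two_ne_zero,
    sub_zero, one_div_mul_eq_div, lt_div_iff₀ (one_sub_norm_sq_pos (hh.norm_lt hz₀))]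
  have hx := one_sub_norm_sq_pos (hh.norm_lt hz₀)
  have hx1 := hh.norm_lt hz₀
  have hy := hh.norm_deriv_pos hU hz₀
  have hd := hf.norm_deriv_pos hU hz₀
  have hle : (1 - (‖h z₀‖ ^ 2) ^ 2) * ‖deriv f z₀‖ ≤ 2 * ‖h z₀‖ * ‖deriv h z₀‖ := by
    rw [hderiv, div_mul_eq_mul_div, le_div_iff₀ (one_sub_norm_sq_pos (hf.norm_lt hz₀))]
    refine mul_le_of_le_one_right (mul_nonneg ?_ hd.le) (sub_le_self _ (sq_nonneg _))
    nlinarith [norm_nonneg (h z₀)]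
  have hamgm : 2 * ‖h z₀‖ < 1 + ‖h z₀‖ ^ 2 := by nlinarith [sq_pos_of_pos (sub_pos.2 hx1)]
  refine lt_of_mul_lt_mul_left ?_ (by positivity : 0 ≤ 1 + ‖h z₀‖ ^ 2)
  calc (1 + ‖h z₀‖ ^ 2) * (‖deriv f z₀‖ * (1 - ‖h z₀‖ ^ 2))
      = (1 - (‖h z₀‖ ^ 2) ^ 2) * ‖deriv f z₀‖ := by ring
    _ ≤ 2 * ‖h z₀‖ * ‖deriv h z₀‖ := hle
    _ < (1 + ‖h z₀‖ ^ 2) * ‖deriv h z₀‖ := mul_lt_mul_of_pos_right hamgm hy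

theorem bddAbove_norm_deriv (hU : IsOpen U) (hz₀ : z₀ ∈ U) :
    BddAbove {x : ℝ | ∃ k, IsDiscEmbedding k U ∧ ‖deriv k z₀‖ = x} := by
  obtain ⟨r, hr, hball⟩ := Metric.isOpen_iff.1 hU z₀ hz₀
  refine ⟨2 * 1 / r, ?_⟩
  rintro _ ⟨k, hk, rfl⟩
  exact Complex.norm_deriv_le_div_of_mapsTo_ball (hk.differentiableOn.mono hball)
    ((mapsTo_closedBall_two_mul (hk.mapsTo.mono_right ball_subset_closedBall) hz₀).mono_left hball)
    hr

theorem of_tendstoLocallyUniformlyOn {ι : Type*} {l : Filter ι} [l.NeBot] {F : ι → ℂ → ℂ}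
    (hU : IsOpen U) (hUc : IsPreconnected U) (hF : ∀ i, IsDiscEmbedding (F i) U)
    (hlim : TendstoLocallyUniformlyOn F f l U) (hz₀ : z₀ ∈ U) (hd : deriv f z₀ ≠ 0) :
    IsDiscEmbedding f U := by
  have hf : DifferentiableOn ℂ f U :=
    hlim.differentiableOn (Eventually.of_forall fun i => (hF i).differentiableOn) hU
  have hinj : InjOn f U := injOn_of_tendstoLocallyUniformlyOn hU hUc hlim
    (fun i => (hF i).differentiableOn) (fun i => (hF i).injOn) hz₀ hd
  have hclosed : MapsTo f U (closedBall 0 1) := fun z hz =>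
    isClosed_closedBall.mem_of_tendsto (hlim.tendsto_at hz)
      (Eventually.of_forall fun i => ball_subset_closedBall ((hF i).mapsTo hz))
  refine ⟨hf, hinj, fun z hz => ?_⟩
  rw [← interior_closedBall (0 : ℂ) one_ne_zero, mem_interior_iff_mem_nhds]
  exact mem_of_superset (nhds_le_map_nhds_of_injOn hU hf hinj hz (image_mem_map (hU.mem_nhds hz)))
    hclosed.image_subset

theorem exists_forall_norm_deriv_le (hU : IsProperSCDomain U) (hz₀ : z₀ ∈ U) :
    ∃ f, IsDiscEmbedding f U ∧ ∀ k, IsDiscEmbedding k U → ‖deriv k z₀‖ ≤ ‖deriv f z₀‖ := by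
  obtain ⟨k₀, hk₀⟩ := exists_isDiscEmbedding hU
  have hbdd := bddAbove_norm_deriv hU.1 hz₀
  set A := {x : ℝ | ∃ k, IsDiscEmbedding k U ∧ ‖deriv k z₀‖ = x}
  obtain ⟨u, -, hu, huA⟩ := exists_seq_tendsto_sSup (S := A) ⟨_, k₀, hk₀, rfl⟩ hbdd
  choose F hF hFu using huA
  obtain ⟨f, hlim⟩ := exists_tendstoLocallyUniformlyOn hU.1 (fun n => (hF n).differentiableOn)
    (fun n => (hF n).mapsTo.mono_right ball_subset_closedBall) (hyperfilter ℕ)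
  have hderiv : ‖deriv f z₀‖ = sSup A := by
    have hlim' := ((hlim.deriv (Eventually.of_forall fun n => (hF n).differentiableOn)
      hU.1).tendsto_at hz₀).norm
    refine tendsto_nhds_unique hlim' ?_
    exact (hu.mono_left Nat.hyperfilter_le_atTop).congr fun n => (hFu n).symm
  have hmax : ∀ k, IsDiscEmbedding k U → ‖deriv k z₀‖ ≤ ‖deriv f z₀‖ := fun k hk => by
    rw [hderiv]; exact le_csSup hbdd ⟨k, hk, rfl⟩
  have hne : deriv f z₀ ≠ 0 :=
    norm_pos_iff.1 ((hk₀.norm_deriv_pos hU.1 hz₀).trans_le (hmax k₀ hk₀))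
  exact ⟨f, of_tendstoLocallyUniformlyOn hU.1 hU.2.1.isPathConnected.isConnected.isPreconnected
    hF hlim hz₀ hne, hmax⟩

end IsDiscEmbedding

end DiscEmbedding

/-- The **Riemann mapping theorem**. -/
theorem exists_isRiemannMap {U : Set ℂ} (hU : IsProperSCDomain U) : ∃ g, IsRiemannMap g U := by
  obtain ⟨z₀, hz₀⟩ := hU.2.1.nonempty
  obtain ⟨f, hf, hmax⟩ := IsDiscEmbedding.exists_forall_norm_deriv_le hU hz₀
  have hsurj : SurjOn f U (ball 0 1) := fun a ha => by
    by_contra hna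
    obtain ⟨k, hk, hlt⟩ := hf.exists_norm_deriv_lt hU.1 hU.2.1 hz₀ (mem_ball_zero_iff.1 ha) hna
    exact hlt.not_ge (hmax k hk)
  have hbij : BijOn f U (ball 0 1) := ⟨hf.mapsTo, hf.injOn, hsurj⟩
  refine ⟨Function.invFunOn f U, fun w hw => ?_, hbij.symm hbij.invOn_invFunOn.symm⟩
  obtain ⟨z, hz, rfl⟩ := hsurj hw
  exact (hasDerivAt_invFunOn hU.1 hf.differentiableOn hf.injOn
    hz).differentiableAt.differentiableWithinAt

/-! ### The distance of the disc -/

/-- The hyperbolic distance of the unit disc, in closed form. -/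
noncomputable def discDist (a b : ℂ) : ℝ :=
  Real.arsinh (‖a - b‖ / √((1 - ‖a‖ ^ 2) * (1 - ‖b‖ ^ 2)))

section DiscDist

variable {a b c w : ℂ}

theorem discDist_comm (a b : ℂ) : discDist a b = discDist b a := by
  rw [discDist, discDist, norm_sub_rev, mul_comm]

theorem discDist_mul_left (hc : ‖c‖ = 1) (a b : ℂ) : discDist (c * a) (c * b) = discDist a b := by
  simp only [discDist, ← mul_sub, norm_mul, hc, one_mul]

theorem discDist_zero_left (hw : ‖w‖ < 1) : discDist 0 w = Real.artanh ‖w‖ := by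
  rw [← Real.arsinh_sinh (Real.artanh ‖w‖),
    Real.sinh_artanh ⟨neg_one_lt_zero.trans_le (norm_nonneg w), hw⟩, discDist]
  simp

theorem sqrt_one_sub_norm_sq_discAut_mul (hc : ‖c‖ < 1) (ha : ‖a‖ < 1) (hb : ‖b‖ < 1) :
    √((1 - ‖discAut c a‖ ^ 2) * (1 - ‖discAut c b‖ ^ 2)) =
      (1 - ‖c‖ ^ 2) * √((1 - ‖a‖ ^ 2) * (1 - ‖b‖ ^ 2)) /
        (‖1 + conj c * a‖ * ‖1 + conj c * b‖) := by
  have hc' := one_sub_norm_sq_pos hc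
  have hx := norm_pos_iff.2 (one_add_conj_mul_ne_zero hc ha.le)
  have hy := norm_pos_iff.2 (one_add_conj_mul_ne_zero hc hb.le)
  have hsq : (1 - ‖discAut c a‖ ^ 2) * (1 - ‖discAut c b‖ ^ 2) =
      ((1 - ‖c‖ ^ 2) / (‖1 + conj c * a‖ * ‖1 + conj c * b‖)) ^ 2 *
        ((1 - ‖a‖ ^ 2) * (1 - ‖b‖ ^ 2)) := by
    rw [one_sub_sq_norm_discAut hc ha.le, one_sub_sq_norm_discAut hc hb.le]
    ring
  rw [hsq, Real.sqrt_mul (sq_nonneg _), Real.sqrt_sq (by positivity), div_mul_eq_mul_div]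

theorem discDist_discAut (hc : ‖c‖ < 1) (ha : ‖a‖ < 1) (hb : ‖b‖ < 1) :
    discDist (discAut c a) (discAut c b) = discDist a b := by
  rw [discDist, discDist, sqrt_one_sub_norm_sq_discAut_mul hc ha hb,
    discAut_sub_discAut hc ha.le hb.le, norm_div, norm_mul, norm_mul,
    norm_one_sub_conj_mul_self hc,
    div_div_div_cancel_right₀ (mul_pos (norm_pos_iff.2 (one_add_conj_mul_ne_zero hc ha.le))
      (norm_pos_iff.2 (one_add_conj_mul_ne_zero hc hb.le))).ne',
    mul_div_mul_left _ _ (one_sub_norm_sq_pos hc).ne']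

theorem discDist_eq_artanh (ha : ‖a‖ < 1) (hb : ‖b‖ < 1) :
    discDist a b = Real.artanh ‖discAut (-a) b‖ := by
  have ha' : ‖-a‖ < 1 := by rwa [norm_neg]
  rw [← discDist_discAut ha' ha hb, discAut_neg_self,
    discDist_zero_left (norm_discAut_lt_one ha' hb)]

end DiscDist

/-- The conformal map of the disc onto the strip `|Im| < π / 4` that maps the real diameter onto
the real axis. As it is an isometry along the diameter and contracts elsewhere, its real part
bounds lengths of curves from below. -/
noncomputable def stripMap (w : ℂ) : ℂ := (Complex.log (1 + w) - Complex.log (1 - w)) / 2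

section StripMap

variable {w : ℂ}

theorem one_add_mem_slitPlane (hw : ‖w‖ < 1) : 1 + w ∈ Complex.slitPlane := by
  left
  rw [Complex.add_re, Complex.one_re]
  linarith [Complex.abs_re_le_norm w, neg_abs_le w.re]

theorem one_sub_mem_slitPlane (hw : ‖w‖ < 1) : 1 - w ∈ Complex.slitPlane := by
  rw [sub_eq_add_neg]
  exact one_add_mem_slitPlane (by rwa [norm_neg])

theorem one_sub_sq_ne_zero (hw : ‖w‖ < 1) : 1 - w ^ 2 ≠ 0 := by
  rw [← one_pow (2 : ℕ), sq_sub_sq]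
  exact mul_ne_zero (Complex.slitPlane_ne_zero (one_add_mem_slitPlane hw))
    (Complex.slitPlane_ne_zero (one_sub_mem_slitPlane hw))

theorem hasDerivAt_stripMap (hw : ‖w‖ < 1) : HasDerivAt stripMap (1 - w ^ 2)⁻¹ w := by
  have hadd := ((hasDerivAt_id w).const_add 1).clog (one_add_mem_slitPlane hw)
  have hsub := ((hasDerivAt_id w).const_sub 1).clog (one_sub_mem_slitPlane hw)
  refine ((hadd.sub hsub).div_const 2).congr_deriv ?_
  have hadd0 := Complex.slitPlane_ne_zero (one_add_mem_slitPlane hw)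
  have hsub0 := Complex.slitPlane_ne_zero (one_sub_mem_slitPlane hw)
  rw [show 1 - w ^ 2 = (1 + w) * (1 - w) by ring]
  simp only [id]
  field_simp
  ring

theorem stripMap_zero : stripMap 0 = 0 := by simp [stripMap]

theorem re_stripMap (w : ℂ) : (stripMap w).re = (Real.log ‖1 + w‖ - Real.log ‖1 - w‖) / 2 := by
  rw [stripMap, Complex.div_ofNat_re, Complex.sub_re, Complex.log_re, Complex.log_re]

theorem stripMap_ofReal {x : ℝ} (h0 : 0 ≤ x) (h1 : x < 1) :
    stripMap x = Real.artanh x := by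
  rw [stripMap, Real.artanh_eq_half_log ⟨by linarith, h1.le⟩,
    Real.log_div (by linarith) (by linarith)]
  push_cast [Complex.ofReal_log (show 0 ≤ 1 + x by linarith),
    Complex.ofReal_log (show 0 ≤ 1 - x by linarith)]
  ring

theorem one_sub_sq_norm_le (w : ℂ) : 1 - ‖w‖ ^ 2 ≤ ‖1 - w ^ 2‖ := by
  rw [← norm_pow]
  simpa only [norm_one] using norm_sub_norm_le (1 : ℂ) (w ^ 2)

end StripMap

section Tanh

theorem one_sub_sq_tanh (x : ℝ) : 1 - Real.tanh x ^ 2 = (Real.cosh x ^ 2)⁻¹ := by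
  rw [Real.tanh_eq_sinh_div_cosh, div_pow, one_sub_div (by positivity), Real.cosh_sq,
    add_sub_cancel_left, one_div]

theorem hasDerivAt_tanh (x : ℝ) : HasDerivAt Real.tanh ((Real.cosh x ^ 2)⁻¹) x := by
  have hquot := (Real.hasDerivAt_sinh x).div (Real.hasDerivAt_cosh x) (Real.cosh_pos x).ne'
  refine (hquot.congr_of_eventuallyEq
    (Eventually.of_forall Real.tanh_eq_sinh_div_cosh)).congr_deriv ?_
  rw [← sq, ← sq, Real.cosh_sq, add_sub_cancel_left, one_div]

theorem tanh_lt_tanh {x y : ℝ} (h : x < y) : Real.tanh x < Real.tanh y := by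
  rwa [← Real.artanh_lt_artanh_iff ⟨Real.neg_one_lt_tanh _, Real.tanh_lt_one _⟩
    ⟨Real.neg_one_lt_tanh _, Real.tanh_lt_one _⟩, Real.artanh_tanh, Real.artanh_tanh]

theorem tanh_pos {x : ℝ} (hx : 0 < x) : 0 < Real.tanh x := by
  simpa only [Real.tanh_zero] using tanh_lt_tanh hx

end Tanh

/-! ### Lengths of piecewise smooth curves -/

section PiecewiseC1

variable {γ : ℝ → ℂ} {a b : ℝ} {m : ℝ → ℝ} {F : ℂ → ℂ} {V : Set ℂ}

theorem IsPiecewiseC1.of_contDiffOn (hab : a ≤ b) (hγ : ContDiffOn ℝ 1 γ (Icc a b)) :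
    IsPiecewiseC1 γ a b := by
  refine ⟨hγ.continuousOn, 1, fun i => if i = 0 then a else b, ?_, if_pos rfl,
    if_neg one_ne_zero, fun i hi => ?_⟩
  · refine monotone_nat_of_le_succ fun n => ?_
    rcases n with _ | n <;> simp [hab]
  · obtain rfl : i = 0 := by omega
    simpa using hγ

theorem intervalIntegrable_deriv_of_contDiffOn (hab : a ≤ b) (hγ : ContDiffOn ℝ 1 γ (Icc a b)) :
    IntervalIntegrable (deriv γ) volume a b := by
  rcases hab.eq_or_lt with rfl | hlt
  · exact IntervalIntegrable.refl
  have hint : IntervalIntegrable (derivWithin γ (Icc a b)) volume a b :=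
    ContinuousOn.intervalIntegrable
      (by rw [uIcc_of_le hab]; exact hγ.continuousOn_derivWithin (uniqueDiffOn_Icc hlt) le_rfl)
  rw [intervalIntegrable_iff_integrableOn_Ioo_of_le hab] at hint ⊢
  exact hint.congr_fun (fun t ht => derivWithin_of_mem_nhds (Icc_mem_nhds ht.1 ht.2))
    measurableSet_Ioo

theorem IsPiecewiseC1.intervalIntegrable_deriv (hγ : IsPiecewiseC1 γ a b) :
    IntervalIntegrable (deriv γ) volume a b := by
  obtain ⟨-, n, t, ht, rfl, rfl, hpiece⟩ := hγ
  exact IntervalIntegrable.trans_iterate fun i hi =>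
    intervalIntegrable_deriv_of_contDiffOn (ht i.le_succ) (hpiece i hi)

theorem norm_sub_le_integral_of_contDiffOn (hab : a ≤ b) (hγ : ContDiffOn ℝ 1 γ (Icc a b))
    (hV : IsOpen V) (hγV : MapsTo γ (Icc a b) V) (hF : DifferentiableOn ℂ F V)
    (hm : IntervalIntegrable m volume a b)
    (hle : ∀ u ∈ Ioo a b, ‖deriv F (γ u)‖ * ‖deriv γ u‖ ≤ m u) :
    ‖F (γ b) - F (γ a)‖ ≤ ∫ u in a..b, m u := by
  have hd : ∀ u ∈ Ioo a b, HasDerivAt (F ∘ γ) (deriv F (γ u) * deriv γ u) u := fun u hu => by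
    have hdγ : DifferentiableAt ℝ γ u :=
      (hγ.differentiableOn one_ne_zero).differentiableAt (Icc_mem_nhds hu.1 hu.2)
    exact (hF.differentiableAt
      (hV.mem_nhds (hγV (Ioo_subset_Icc_self hu)))).hasDerivAt.comp_of_eq u hdγ.hasDerivAt rfl
  refine norm_sub_le_integral_of_norm_deriv_le_of_le (f := F ∘ γ) hab
    (hF.continuousOn.comp hγ.continuousOn hγV)
    (fun u hu => (hd u hu).differentiableAt.differentiableWithinAt)
    (Eventually.of_forall fun u hu => ?_) hm
  rw [(hd u hu).deriv, norm_mul]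
  exact hle u hu

theorem IsPiecewiseC1.norm_sub_le_integral (hγ : IsPiecewiseC1 γ a b) (hV : IsOpen V)
    (hγV : MapsTo γ (Icc a b) V) (hF : DifferentiableOn ℂ F V)
    (hm : IntervalIntegrable m volume a b)
    (hle : ∀ u ∈ Ioo a b, ‖deriv F (γ u)‖ * ‖deriv γ u‖ ≤ m u) :
    ‖F (γ b) - F (γ a)‖ ≤ ∫ u in a..b, m u := by
  obtain ⟨-, n, t, ht, rfl, rfl, hpiece⟩ := hγ
  have hsub : ∀ i < n, Icc (t i) (t (i + 1)) ⊆ Icc (t 0) (t n) := fun i hi =>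
    Icc_subset_Icc (ht (Nat.zero_le i)) (ht hi)
  have hmi : ∀ i < n, IntervalIntegrable m volume (t i) (t (i + 1)) := fun i hi =>
    hm.mono_set (by
      rw [uIcc_of_le (ht i.le_succ), uIcc_of_le (ht (Nat.zero_le n))]
      exact hsub i hi)
  rw [← intervalIntegral.sum_integral_adjacent_intervals hmi,
    ← Finset.sum_range_sub (fun i => F (γ (t i)))]
  refine (norm_sum_le _ _).trans (Finset.sum_le_sum fun i hi => ?_)
  rw [Finset.mem_range] at hi
  exact norm_sub_le_integral_of_contDiffOn (ht i.le_succ) (hpiece i hi) hV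
    (hγV.mono_left (hsub i hi)) hF (hmi i hi)
    fun u hu => hle u (Ioo_subset_Ioo (ht (Nat.zero_le i)) (ht hi) hu)

end PiecewiseC1

theorem hypLength_nonneg (U : Set ℂ) (γ : ℝ → ℂ) {s t : ℝ} (hst : s ≤ t) :
    0 ≤ hypLength U γ s t :=
  intervalIntegral.integral_nonneg hst fun _ _ => kappa_nonneg _ _ _

theorem hypDist_nonneg (U : Set ℂ) (z w : ℂ) : 0 ≤ hypDist U z w :=
  Real.sInf_nonneg (by rintro L ⟨γ, -, -, -, -, rfl⟩; exact hypLength_nonneg U γ zero_le_one)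

/-- The ray of the disc from `0` in direction `e` (for `‖e‖ = 1`), of constant hyperbolic
speed `r`. -/
noncomputable def ray (e : ℂ) (r t : ℝ) : ℂ := e * (Real.tanh (r * t) : ℂ)

theorem norm_ray {e : ℂ} (he : ‖e‖ = 1) (r t : ℝ) : ‖ray e r t‖ = |Real.tanh (r * t)| := by
  rw [ray, norm_mul, he, one_mul, Complex.norm_real, Real.norm_eq_abs]

theorem norm_ray_lt {e : ℂ} (he : ‖e‖ = 1) (r t : ℝ) : ‖ray e r t‖ < 1 := by
  rw [norm_ray he]
  exact Real.abs_tanh_lt_one _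

theorem ray_zero (e : ℂ) (r : ℝ) : ray e r 0 = 0 := by simp [ray]

theorem hasDerivAt_ray (e : ℂ) (r t : ℝ) :
    HasDerivAt (ray e r) (e * (((Real.cosh (r * t) ^ 2)⁻¹ * r : ℝ) : ℂ)) t := by
  have htanh : HasDerivAt (fun t : ℝ => Real.tanh (r * t)) ((Real.cosh (r * t) ^ 2)⁻¹ * r) t :=
    (hasDerivAt_tanh (r * t)).comp t (by simpa using (hasDerivAt_id t).const_mul r)
  exact htanh.ofReal_comp.const_mul e

theorem continuous_deriv_ray (e : ℂ) (r : ℝ) : Continuous (deriv (ray e r)) := by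
  rw [funext fun t => (hasDerivAt_ray e r t).deriv]
  refine continuous_const.mul (Complex.continuous_ofReal.comp (Continuous.mul ?_ continuous_const))
  exact Continuous.inv₀ (by fun_prop) fun t => (pow_pos (Real.cosh_pos _) 2).ne'

namespace IsRiemannMap

variable {f : ℂ → ℂ} {U : Set ℂ} {e a b w z : ℂ} {γ : ℝ → ℂ}

theorem continuousOn_riemannInv (hf : IsRiemannMap f U) : ContinuousOn (riemannInv f) U :=
  hf.differentiableOn_riemannInv.continuousOn

theorem continuousOn_kappa_one (hf : IsRiemannMap f U) : ContinuousOn (fun w => kappa U w 1) U := by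
  have hd : ContinuousOn (fun w => deriv f (riemannInv f w)) U :=
    (hf.1.deriv isOpen_ball).continuousOn.comp hf.continuousOn_riemannInv fun w hw =>
      mem_ball_zero_iff.2 (hf.norm_riemannInv_lt hw)
  have hinv := hf.continuousOn_riemannInv
  refine ContinuousOn.congr (ContinuousOn.div₀ continuousOn_const
    (g := fun w => ‖deriv f (riemannInv f w)‖ * (1 - ‖riemannInv f w‖ ^ 2)) (by fun_prop)
    fun w hw => ?_) fun w hw => hf.kappa_eq hw 1
  exact mul_ne_zero (norm_ne_zero_iff.2 (hf.deriv_ne_zero (hf.norm_riemannInv_lt hw)))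
    (one_sub_norm_sq_pos (hf.norm_riemannInv_lt hw)).ne'

theorem kappa_eq_kappa_one_mul (hf : IsRiemannMap f U) (hw : w ∈ U) (v : ℂ) :
    kappa U w v = kappa U w 1 * ‖v‖ := by
  rw [hf.kappa_eq hw, hf.kappa_eq hw, norm_one, one_div, inv_mul_eq_div]

theorem intervalIntegrable_kappa (hf : IsRiemannMap f U) {x y : ℝ} (hxy : x ≤ y)
    (hγ : IsPiecewiseC1 γ x y) (hm : MapsTo γ (Icc x y) U) :
    IntervalIntegrable (fun u => kappa U (γ u) (deriv γ u)) volume x y := by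
  have hdensity : ContinuousOn (fun u => kappa U (γ u) 1) (uIcc x y) := by
    rw [uIcc_of_le hxy]
    exact hf.continuousOn_kappa_one.comp hγ.1 hm
  refine (hγ.intervalIntegrable_deriv.norm.continuousOn_mul hdensity).congr fun u hu => ?_
  rw [uIoc_of_le hxy] at hu
  exact (hf.kappa_eq_kappa_one_mul (hm (Ioc_subset_Icc_self hu)) _).symm

theorem hasDerivAt_stripMap_mul_riemannInv (hf : IsRiemannMap f U) (he : ‖e‖ = 1) (hw : w ∈ U) :
    HasDerivAt (fun w => stripMap (e * riemannInv f w))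
      ((1 - (e * riemannInv f w) ^ 2)⁻¹ * (e * (deriv f (riemannInv f w))⁻¹)) w := by
  have hlt : ‖e * riemannInv f w‖ < 1 := by
    rw [norm_mul, he, one_mul]; exact hf.norm_riemannInv_lt hw
  exact (hasDerivAt_stripMap hlt).comp w ((hf.hasDerivAt_riemannInv hw).const_mul e)

theorem norm_deriv_stripMap_mul_riemannInv_le (hf : IsRiemannMap f U) (he : ‖e‖ = 1)
    (hw : w ∈ U) (v : ℂ) :
    ‖deriv (fun w => stripMap (e * riemannInv f w)) w‖ * ‖v‖ ≤ kappa U w v := by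
  have hlt := hf.norm_riemannInv_lt hw
  have hpos := one_sub_norm_sq_pos hlt
  have hle : 1 - ‖riemannInv f w‖ ^ 2 ≤ ‖1 - (e * riemannInv f w) ^ 2‖ := by
    simpa only [norm_mul, he, one_mul] using one_sub_sq_norm_le (e * riemannInv f w)
  have hd := norm_pos_iff.2 (hf.deriv_ne_zero hlt)
  rw [(hf.hasDerivAt_stripMap_mul_riemannInv he hw).deriv, hf.kappa_eq hw, norm_mul, norm_inv,
    norm_mul, he, one_mul, norm_inv, ← mul_inv, mul_comm ‖1 - _‖, inv_mul_eq_div]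
  gcongr

/-- Any bound for the hyperbolic speed of a curve bounds the distance of its end points: rotate
so that they lie on the diameter that `stripMap` maps isometrically. -/
theorem artanh_le_integral (hf : IsRiemannMap f U) {x y : ℝ} (hγ : IsPiecewiseC1 γ x y)
    (hm : MapsTo γ (Icc x y) U) (hw : ‖w‖ < 1) (hx : γ x = f 0) (hy : γ y = f w) {m : ℝ → ℝ}
    (hmi : IntervalIntegrable m volume x y)
    (hle : ∀ u ∈ Ioo x y, kappa U (γ u) (deriv γ u) ≤ m u) :
    Real.artanh ‖w‖ ≤ ∫ u in x..y, m u := by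
  obtain ⟨e, he, hew⟩ := RCLike.exists_norm_eq_mul_self w
  have hstrip := hγ.norm_sub_le_integral hf.isOpen hm
    (F := fun w => stripMap (e * riemannInv f w)) (fun w hw =>
      (hf.hasDerivAt_stripMap_mul_riemannInv he hw).differentiableAt.differentiableWithinAt) hmi
    fun u hu => (hf.norm_deriv_stripMap_mul_riemannInv_le he
      (hm (Ioo_subset_Icc_self hu)) _).trans (hle u hu)
  simp only [hx, hy, hf.riemannInv_apply hw, hf.riemannInv_apply_zero, ← hew, mul_zero,
    stripMap_zero, sub_zero] at hstrip
  refine le_trans ?_ hstrip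
  rw [RCLike.ofReal_eq_complex_ofReal, stripMap_ofReal (norm_nonneg w) hw, Complex.norm_real]
  exact le_abs_self _

theorem hasDerivAt_comp_ray (hf : IsRiemannMap f U) (he : ‖e‖ = 1) (r t : ℝ) :
    HasDerivAt (f ∘ ray e r)
      (deriv f (ray e r t) * (e * (((Real.cosh (r * t) ^ 2)⁻¹ * r : ℝ) : ℂ))) t :=
  (hf.differentiableAt (norm_ray_lt he r t)).hasDerivAt.comp_of_eq t (hasDerivAt_ray e r t) rfl

theorem contDiff_comp_ray (hf : IsRiemannMap f U) (he : ‖e‖ = 1) (r : ℝ) :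
    ContDiff ℝ 1 (f ∘ ray e r) := by
  refine contDiff_one_iff_deriv.2 ⟨fun t => (hf.hasDerivAt_comp_ray he r t).differentiableAt, ?_⟩
  have hderiv : deriv (f ∘ ray e r) = fun t => deriv f (ray e r t) * deriv (ray e r) t :=
    funext fun t => by
      rw [(hf.hasDerivAt_comp_ray he r t).deriv, (hasDerivAt_ray e r t).deriv]
  have hray : Continuous (ray e r) :=
    continuous_iff_continuousAt.2 fun t => (hasDerivAt_ray e r t).continuousAt
  rw [hderiv]
  exact ((hf.1.deriv isOpen_ball).continuousOn.comp_continuous hray fun t =>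
    mem_ball_zero_iff.2 (norm_ray_lt he r t)).mul (continuous_deriv_ray e r)

theorem kappa_comp_ray (hf : IsRiemannMap f U) (he : ‖e‖ = 1) {r : ℝ} (hr : 0 ≤ r) (t : ℝ) :
    kappa U ((f ∘ ray e r) t) (deriv (f ∘ ray e r) t) = r := by
  have hd := norm_pos_iff.2 (hf.deriv_ne_zero (norm_ray_lt he r t))
  have hcosh := inv_pos.2 (pow_pos (Real.cosh_pos (r * t)) 2)
  rw [(hf.hasDerivAt_comp_ray he r t).deriv, Function.comp_apply,
    hf.kappa_apply (norm_ray_lt he r t), norm_ray he, sq_abs, one_sub_sq_tanh, norm_mul, norm_mul,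
    he, one_mul, Complex.norm_real, Real.norm_of_nonneg (by positivity), ← mul_assoc,
    mul_div_cancel_left₀ _ (mul_pos hd hcosh).ne']

theorem hypLength_comp_ray (hf : IsRiemannMap f U) (he : ‖e‖ = 1) {r : ℝ} (hr : 0 ≤ r)
    (s t : ℝ) : hypLength U (f ∘ ray e r) s t = (t - s) * r := by
  simp only [hypLength, hf.kappa_comp_ray he hr, intervalIntegral.integral_const, smul_eq_mul]

theorem exists_hypLength_eq_artanh (hf : IsRiemannMap f U) (hw : ‖w‖ < 1) :
    ∃ γ : ℝ → ℂ, IsPiecewiseC1 γ 0 1 ∧ MapsTo γ (Icc 0 1) U ∧ γ 0 = f 0 ∧ γ 1 = f w ∧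
      Real.artanh ‖w‖ = hypLength U γ 0 1 := by
  obtain ⟨e, he, hew⟩ := RCLike.exists_norm_mul_eq_self w
  have hend : ray e (Real.artanh ‖w‖) 1 = w := by
    rw [ray, mul_one, Real.tanh_artanh ⟨neg_one_lt_zero.trans_le (norm_nonneg w), hw⟩]
    exact hew
  refine ⟨f ∘ ray e (Real.artanh ‖w‖),
    .of_contDiffOn zero_le_one (hf.contDiff_comp_ray he _).contDiffOn,
    fun t _ => hf.mem (norm_ray_lt he _ t), by rw [Function.comp_apply, ray_zero],
    by rw [Function.comp_apply, hend], ?_⟩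
  rw [hf.hypLength_comp_ray he (Real.artanh_nonneg (norm_nonneg w)), sub_zero, one_mul]

theorem hypDist_apply_zero (hf : IsRiemannMap f U) (hw : ‖w‖ < 1) :
    hypDist U (f 0) (f w) = Real.artanh ‖w‖ := by
  refine IsLeast.csInf_eq ⟨hf.exists_hypLength_eq_artanh hw, ?_⟩
  rintro L ⟨γ, hγ, hm, h0, h1, rfl⟩
  exact hf.artanh_le_integral hγ hm hw h0 h1 (hf.intervalIntegrable_kappa zero_le_one hγ hm)
    fun _ _ => le_rfl

theorem hypDist_apply (hf : IsRiemannMap f U) (ha : ‖a‖ < 1) (hb : ‖b‖ < 1) :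
    hypDist U (f a) (f b) = discDist a b := by
  have hzero := (hf.comp_discAut ha).hypDist_apply_zero
    (norm_discAut_lt_one (a := -a) (by rwa [norm_neg]) hb)
  rwa [Function.comp_apply, Function.comp_apply, discAut_zero, discAut_discAut_neg ha hb.le,
    ← discDist_eq_artanh ha hb] at hzero

theorem hypDist_eq (hf : IsRiemannMap f U) (hz : z ∈ U) (hw : w ∈ U) :
    hypDist U z w = discDist (riemannInv f z) (riemannInv f w) := by
  simpa only [hf.apply_riemannInv hz, hf.apply_riemannInv hw] using
    hf.hypDist_apply (hf.norm_riemannInv_lt hz) (hf.norm_riemannInv_lt hw)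

end IsRiemannMap

/-! ### Comparison with the upper half-plane -/

/-- The nearest-point projection of the upper half-plane onto the imaginary axis. -/
noncomputable def axisProj (u : UpperHalfPlane) : UpperHalfPlane :=
  UpperHalfPlane.mk ⟨0, ‖(u : ℂ)‖⟩ (norm_pos_iff.2 u.ne_zero)

section AxisProj

variable (u v : UpperHalfPlane)

theorem cosh_dist_axisProj : Real.cosh (dist u (axisProj v)) =
    (‖(u : ℂ)‖ ^ 2 + ‖(v : ℂ)‖ ^ 2) / (2 * u.im * ‖(v : ℂ)‖) := by
  rw [UpperHalfPlane.cosh_dist', ← Complex.normSq_eq_norm_sq (u : ℂ), Complex.normSq_apply,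
    UpperHalfPlane.coe_re, UpperHalfPlane.coe_im]
  change ((u.re - 0) ^ 2 + u.im ^ 2 + ‖(v : ℂ)‖ ^ 2) / (2 * u.im * ‖(v : ℂ)‖) = _
  ring

theorem norm_div_im_le_cosh_dist_axisProj :
    ‖(u : ℂ)‖ / u.im ≤ Real.cosh (dist u (axisProj v)) := by
  have hu := u.im_pos
  have hv : 0 < ‖(v : ℂ)‖ := norm_pos_iff.2 v.ne_zero
  rw [cosh_dist_axisProj, div_le_div_iff₀ hu (by positivity)]
  nlinarith [mul_nonneg hu.le (sq_nonneg (‖(u : ℂ)‖ - ‖(v : ℂ)‖))]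

theorem dist_axisProj_self_le : dist u (axisProj u) ≤ ‖(u : ℂ)‖ / u.im := by
  have hcosh : Real.cosh (dist u (axisProj u)) = ‖(u : ℂ)‖ / u.im := by
    have hnorm : 0 < ‖(u : ℂ)‖ := norm_pos_iff.2 u.ne_zero
    rw [cosh_dist_axisProj]
    field_simp
    norm_num
  rw [← hcosh]
  exact (Real.self_le_sinh_iff.2 dist_nonneg).trans (Real.sinh_lt_cosh _).le

theorem dist_axisProj : dist (axisProj u) (axisProj v) =
    |Real.log ‖(u : ℂ)‖ - Real.log ‖(v : ℂ)‖| :=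
  UpperHalfPlane.dist_of_re_eq (z := axisProj u) (w := axisProj v) rfl

end AxisProj

theorem im_I_mul_one_add_div_one_sub (w : ℂ) :
    (Complex.I * ((1 + w) / (1 - w))).im = (1 - ‖w‖ ^ 2) / ‖1 - w‖ ^ 2 := by
  rw [Complex.I_mul_im, Complex.div_re, ← Complex.normSq_eq_norm_sq, ← Complex.normSq_eq_norm_sq,
    ← add_div, Complex.normSq_apply w]
  simp only [Complex.add_re, Complex.add_im, Complex.sub_re, Complex.sub_im, Complex.one_re,
    Complex.one_im]
  ring

/-- The Cayley transform from the disc to the upper half-plane. -/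
noncomputable def cayley (w : ℂ) (hw : ‖w‖ < 1) : UpperHalfPlane :=
  UpperHalfPlane.mk (Complex.I * ((1 + w) / (1 - w))) (by
    rw [im_I_mul_one_add_div_one_sub]
    exact div_pos (one_sub_norm_sq_pos hw)
      (pow_pos (norm_pos_iff.2 (Complex.slitPlane_ne_zero (one_sub_mem_slitPlane hw))) 2))

/-- The reciprocal of the hyperbolic cosine of twice the distance to the real diameter. -/
noncomputable def axisCos (w : ℂ) : ℝ := (1 - ‖w‖ ^ 2) / ‖1 - w ^ 2‖

section Cayley

variable {a b w : ℂ}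

theorem im_cayley (hw : ‖w‖ < 1) : (cayley w hw).im = (1 - ‖w‖ ^ 2) / ‖1 - w‖ ^ 2 :=
  im_I_mul_one_add_div_one_sub w

theorem norm_cayley (hw : ‖w‖ < 1) : ‖(cayley w hw : ℂ)‖ = ‖1 + w‖ / ‖1 - w‖ := by
  change ‖Complex.I * ((1 + w) / (1 - w))‖ = _
  rw [norm_mul, Complex.norm_I, one_mul, norm_div]

theorem dist_coe_cayley (ha : ‖a‖ < 1) (hb : ‖b‖ < 1) :
    dist (cayley a ha : ℂ) (cayley b hb) = 2 * ‖a - b‖ / (‖1 - a‖ * ‖1 - b‖) := by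
  change dist (Complex.I * ((1 + a) / (1 - a))) (Complex.I * ((1 + b) / (1 - b))) = _
  rw [dist_eq_norm, ← mul_sub, div_sub_div _ _
      (Complex.slitPlane_ne_zero (one_sub_mem_slitPlane ha))
      (Complex.slitPlane_ne_zero (one_sub_mem_slitPlane hb)),
    show (1 + a) * (1 - b) - (1 - a) * (1 + b) = 2 * (a - b) by ring, norm_mul, Complex.norm_I,
    one_mul, norm_div, norm_mul, norm_mul, Complex.norm_two]

theorem dist_cayley (ha : ‖a‖ < 1) (hb : ‖b‖ < 1) :
    dist (cayley a ha) (cayley b hb) = 2 * discDist a b := by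
  have ha1 := norm_pos_iff.2 (Complex.slitPlane_ne_zero (one_sub_mem_slitPlane ha))
  have hb1 := norm_pos_iff.2 (Complex.slitPlane_ne_zero (one_sub_mem_slitPlane hb))
  have him : (cayley a ha).im * (cayley b hb).im =
      ((1 - ‖a‖ ^ 2) * (1 - ‖b‖ ^ 2)) * ((‖1 - a‖ * ‖1 - b‖)⁻¹) ^ 2 := by
    rw [im_cayley, im_cayley]
    ring
  have hpos := mul_pos (one_sub_norm_sq_pos ha) (one_sub_norm_sq_pos hb)
  rw [UpperHalfPlane.dist_eq, dist_coe_cayley, him, Real.sqrt_mul hpos.le,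
    Real.sqrt_sq (by positivity), discDist]
  congr 2
  field_simp [(Real.sqrt_pos.2 hpos).ne']

theorem axisCos_pos (hw : ‖w‖ < 1) : 0 < axisCos w :=
  div_pos (one_sub_norm_sq_pos hw) (norm_pos_iff.2 (one_sub_sq_ne_zero hw))

theorem axisCos_ofReal {x : ℝ} (hx : |x| < 1) : axisCos x = 1 := by
  have hpos : 0 < 1 - x ^ 2 := sub_pos.2 ((sq_lt_one_iff_abs_lt_one x).2 hx)
  rw [axisCos, Complex.norm_real, Real.norm_eq_abs, sq_abs, ← Complex.ofReal_pow,
    ← Complex.ofReal_one, ← Complex.ofReal_sub, Complex.norm_real, Real.norm_of_nonneg hpos.le,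
    div_self hpos.ne']

theorem norm_cayley_div_im (hw : ‖w‖ < 1) :
    ‖(cayley w hw : ℂ)‖ / (cayley w hw).im = (axisCos w)⁻¹ := by
  have hsub := norm_pos_iff.2 (Complex.slitPlane_ne_zero (one_sub_mem_slitPlane hw))
  have hpos := one_sub_norm_sq_pos hw
  rw [norm_cayley, im_cayley, axisCos, show 1 - w ^ 2 = (1 + w) * (1 - w) by ring, norm_mul]
  field_simp

theorem log_norm_cayley (hw : ‖w‖ < 1) :
    Real.log ‖(cayley w hw : ℂ)‖ = 2 * (stripMap w).re := by
  rw [norm_cayley, re_stripMap, Real.log_div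
    (norm_ne_zero_iff.2 (Complex.slitPlane_ne_zero (one_add_mem_slitPlane hw)))
    (norm_ne_zero_iff.2 (Complex.slitPlane_ne_zero (one_sub_mem_slitPlane hw))),
    mul_div_cancel₀ _ two_ne_zero]

theorem dist_cayley_axisProj_le (ha : ‖a‖ < 1) {ε : ℝ} (hε : 0 < ε) (haε : ε ≤ axisCos a) :
    dist (cayley a ha) (axisProj (cayley a ha)) ≤ ε⁻¹ :=
  (dist_axisProj_self_le _).trans ((norm_cayley_div_im ha).trans_le (inv_anti₀ hε haε))

theorem discDist_le_of_le_axisCos (ha : ‖a‖ < 1) (hb : ‖b‖ < 1) {ε : ℝ} (hε : 0 < ε)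
    (haε : ε ≤ axisCos a) (hbε : ε ≤ axisCos b) :
    discDist a b ≤ ε⁻¹ + |(stripMap a).re - (stripMap b).re| := by
  have hproj : dist (axisProj (cayley a ha)) (axisProj (cayley b hb)) =
      2 * |(stripMap a).re - (stripMap b).re| := by
    rw [dist_axisProj, log_norm_cayley, log_norm_cayley, ← mul_sub, abs_mul, abs_two]
  have htri := dist_triangle4 (cayley a ha) (axisProj (cayley a ha)) (axisProj (cayley b hb))
    (cayley b hb)
  rw [dist_cayley, hproj, dist_comm _ (cayley b hb)] at htri
  linarith [dist_cayley_axisProj_le ha hε haε, dist_cayley_axisProj_le hb hε hbε]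

theorem le_axisCos_of_discDist_le (ha : ‖a‖ < 1) (hb : ‖b‖ < 1) {ε M : ℝ} (hε : 0 < ε)
    (haε : ε ≤ axisCos a) (hM : discDist a b ≤ M) :
    (Real.cosh (2 * M + ε⁻¹))⁻¹ ≤ axisCos b := by
  have hcosh := norm_div_im_le_cosh_dist_axisProj (cayley b hb) (cayley a ha)
  have htri := dist_triangle_left (cayley b hb) (axisProj (cayley a ha)) (cayley a ha)
  rw [dist_cayley] at htri
  rw [norm_cayley_div_im] at hcosh
  refine inv_le_of_inv_le₀ (axisCos_pos hb) (hcosh.trans ?_)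
  rw [Real.cosh_le_cosh, abs_of_nonneg dist_nonneg]
  exact le_trans (by linarith [dist_cayley_axisProj_le ha hε haε]) (le_abs_self _)

end Cayley

/-! ### Stability of quasi-geodesics of the disc -/

section Crossing

variable {α β : Type*} [LinearOrder α] [TopologicalSpace α] [OrderTopology α] [CompactIccSpace α]
  [LinearOrder β] [TopologicalSpace β] [OrderClosedTopology β] {g : α → β} {a b : α} {ε : β}

theorem isCompact_Icc_inter_preimage_Ici (hg : ContinuousOn g (Icc a b)) (ε : β) :
    IsCompact (Icc a b ∩ g ⁻¹' Ici ε) :=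
  isCompact_Icc.of_isClosed_subset (hg.preimage_isClosed_of_isClosed isClosed_Icc isClosed_Ici)
    inter_subset_left

theorem exists_le_and_forall_Ioc_lt (hg : ContinuousOn g (Icc a b)) (hab : a ≤ b)
    (ha : ε ≤ g a) : ∃ s ∈ Icc a b, ε ≤ g s ∧ ∀ u ∈ Ioc s b, g u < ε := by
  obtain ⟨s, ⟨hs, hεs⟩, hmax⟩ :=
    (isCompact_Icc_inter_preimage_Ici hg ε).exists_isGreatest ⟨a, left_mem_Icc.2 hab, ha⟩
  exact ⟨s, hs, hεs, fun u hu => not_le.1 fun hle =>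
    hu.1.not_ge (hmax ⟨⟨hs.1.trans hu.1.le, hu.2⟩, hle⟩)⟩

theorem exists_le_and_forall_Ico_lt (hg : ContinuousOn g (Icc a b)) (hab : a ≤ b)
    (hb : ε ≤ g b) : ∃ s ∈ Icc a b, ε ≤ g s ∧ ∀ u ∈ Ico a s, g u < ε := by
  obtain ⟨s, ⟨hs, hεs⟩, hmin⟩ :=
    (isCompact_Icc_inter_preimage_Ici hg ε).exists_isLeast ⟨b, right_mem_Icc.2 hab, hb⟩
  exact ⟨s, hs, hεs, fun u hu => not_le.1 fun hle =>
    hu.2.not_ge (hmin ⟨⟨hu.1, hu.2.le.trans hs.2⟩, hle⟩)⟩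

end Crossing

theorem isRiemannMap_id : IsRiemannMap id (ball 0 1) :=
  ⟨differentiableOn_id, bijOn_id _⟩

theorem kappa_ball {a : ℂ} (ha : ‖a‖ < 1) (v : ℂ) :
    kappa (ball 0 1) a v = ‖v‖ / (1 - ‖a‖ ^ 2) := by
  simpa using isRiemannMap_id.kappa_apply ha v

section Disc

variable {w : ℂ}

theorem continuousOn_axisCos : ContinuousOn axisCos (ball 0 1) :=
  ContinuousOn.div (by fun_prop) (by fun_prop) fun _ hw =>
    norm_ne_zero_iff.2 (one_sub_sq_ne_zero (mem_ball_zero_iff.1 hw))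

theorem norm_le_tanh_of_discDist_zero_le (hw : ‖w‖ < 1) {M : ℝ} (hM : discDist 0 w ≤ M) :
    ‖w‖ ≤ Real.tanh M := by
  rw [discDist_zero_left hw] at hM
  rwa [← Real.artanh_le_artanh_iff ⟨neg_one_lt_zero.trans_le (norm_nonneg w), hw⟩
    ⟨Real.neg_one_lt_tanh _, Real.tanh_lt_one _⟩, Real.artanh_tanh]

theorem norm_one_sub_le_of_norm_le (hw : ‖w‖ < 1) {ρ : ℝ} (hρ : ρ < 1) (hwρ : ‖w‖ ≤ ρ) :
    ‖1 - w‖ ≤ 2 / (1 - ρ) * (1 - ‖w‖) := by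
  have htwo : ‖1 - w‖ ≤ 2 := (norm_sub_le _ _).trans (by rw [norm_one]; linarith)
  rw [div_mul_eq_mul_div, le_div_iff₀ (sub_pos.2 hρ)]
  exact mul_le_mul htwo (by linarith) (sub_pos.2 hρ).le zero_le_two

theorem norm_one_sub_le_of_re_stripMap_nonneg (hw : ‖w‖ < 1) {δ : ℝ} (hδ : 0 < δ)
    (hδw : δ ≤ axisCos w) (hre : 0 ≤ (stripMap w).re) : ‖1 - w‖ ≤ 2 / δ * (1 - ‖w‖) := by
  have hadd := norm_pos_iff.2 (Complex.slitPlane_ne_zero (one_add_mem_slitPlane hw))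
  have hsub := norm_pos_iff.2 (Complex.slitPlane_ne_zero (one_sub_mem_slitPlane hw))
  have hle : ‖1 - w‖ ≤ ‖1 + w‖ := by
    rw [re_stripMap] at hre
    exact (Real.log_le_log_iff hsub hadd).1 (by linarith)
  have hone : 1 ≤ ‖1 + w‖ := by
    have htwo : ‖(1 + w) + (1 - w)‖ ≤ ‖1 + w‖ + ‖1 - w‖ := norm_add_le _ _
    rw [show (1 + w) + (1 - w) = 2 by ring, Complex.norm_ofNat] at htwo
    linarith
  rw [axisCos, show 1 - w ^ 2 = (1 + w) * (1 - w) by ring, norm_mul,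
    le_div_iff₀ (by positivity)] at hδw
  rw [div_mul_eq_mul_div, le_div_iff₀ hδ]
  calc ‖1 - w‖ * δ ≤ δ * (‖1 + w‖ * ‖1 - w‖) := by
        rw [mul_comm]; gcongr; exact le_mul_of_one_le_left hsub.le hone
    _ ≤ (1 + ‖w‖) * (1 - ‖w‖) := hδw.trans_eq (by ring)
    _ ≤ 2 * (1 - ‖w‖) := by gcongr; linarith

end Disc

/-- A curve in the disc, parametrized on `[0, +∞)`, whose hyperbolic speed is at most `C` times a
density `m` the integral of which is at most the hyperbolic distance of the end points. -/
structure IsQuasiGeodesicRay (c : ℝ → ℂ) (m : ℝ → ℝ) (C : ℝ) : Prop where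
  norm_lt : ∀ t, 0 ≤ t → ‖c t‖ < 1
  contDiffOn : ContDiffOn ℝ 1 c (Ici 0)
  density_nonneg : ∀ t, 0 ≤ m t
  integrable : ∀ s t, 0 ≤ s → s ≤ t → IntervalIntegrable m volume s t
  speed_le : ∀ t, 0 < t → ‖deriv c t‖ ≤ C * m t * (1 - ‖c t‖ ^ 2)
  integral_le : ∀ s t, 0 ≤ s → s ≤ t → ∫ u in s..t, m u ≤ discDist (c s) (c t)

namespace IsQuasiGeodesicRay

variable {c : ℝ → ℂ} {m : ℝ → ℝ} {C s t T r δ ε : ℝ}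

theorem isPiecewiseC1 (h : IsQuasiGeodesicRay c m C) (hs : 0 ≤ s) (hst : s ≤ t) :
    IsPiecewiseC1 c s t :=
  .of_contDiffOn hst (h.contDiffOn.mono fun _ hu => hs.trans hu.1)

theorem mapsTo_ball (h : IsQuasiGeodesicRay c m C) : MapsTo c (Ici 0) (ball 0 1) :=
  fun t ht => mem_ball_zero_iff.2 (h.norm_lt t ht)

theorem continuousOn_axisCos_comp (h : IsQuasiGeodesicRay c m C) :
    ContinuousOn (fun t => axisCos (c t)) (Ici 0) :=
  continuousOn_axisCos.comp h.contDiffOn.continuousOn h.mapsTo_ball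

theorem continuousOn_re_stripMap_comp (h : IsQuasiGeodesicRay c m C) :
    ContinuousOn (fun t => (stripMap (c t)).re) (Ici 0) := by
  have hstrip : ContinuousOn stripMap (ball 0 1) := fun w hw =>
    (hasDerivAt_stripMap (mem_ball_zero_iff.1 hw)).continuousAt.continuousWithinAt
  exact Complex.continuous_re.comp_continuousOn
    (hstrip.comp h.contDiffOn.continuousOn h.mapsTo_ball)

theorem integral_mono_right (h : IsQuasiGeodesicRay c m C) (hs : 0 ≤ s) (hst : s ≤ t)
    (htr : t ≤ r) : ∫ u in s..t, m u ≤ ∫ u in s..r, m u :=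
  intervalIntegral.integral_mono_interval le_rfl hst htr
    (Eventually.of_forall h.density_nonneg) (h.integrable s r hs (hst.trans htr))

theorem discDist_le (h : IsQuasiGeodesicRay c m C) (hs : 0 ≤ s) (hst : s ≤ t) :
    discDist (c s) (c t) ≤ C * ∫ u in s..t, m u := by
  have ha := h.norm_lt s hs
  have hb := h.norm_lt t (hs.trans hst)
  rw [discDist_eq_artanh ha hb, ← intervalIntegral.integral_const_mul]
  refine (isRiemannMap_id.comp_discAut ha).artanh_le_integral (h.isPiecewiseC1 hs hst)
    (h.mapsTo_ball.mono_left fun u hu => hs.trans hu.1)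
    (norm_discAut_lt_one (by rwa [norm_neg]) hb) (by simp [discAut_zero])
    (by simp [discAut_discAut_neg ha hb.le]) ((h.integrable s t hs hst).const_mul C)
    fun u hu => ?_
  have hu0 := hs.trans_lt hu.1
  rw [kappa_ball (h.norm_lt u hu0.le), div_le_iff₀ (one_sub_norm_sq_pos (h.norm_lt u hu0.le))]
  exact h.speed_le u hu0

theorem const_mul (h : IsQuasiGeodesicRay c m C) {e : ℂ} (he : ‖e‖ = 1) :
    IsQuasiGeodesicRay (fun t => e * c t) m C where
  norm_lt t ht := by simpa [he] using h.norm_lt t ht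
  contDiffOn := contDiffOn_const.mul h.contDiffOn
  density_nonneg := h.density_nonneg
  integrable := h.integrable
  speed_le t ht := by
    have hd : DifferentiableAt ℝ c t :=
      (h.contDiffOn.differentiableOn one_ne_zero).differentiableAt (Ici_mem_nhds ht)
    rw [deriv_const_mul _ hd, norm_mul, norm_mul, he, one_mul, one_mul]
    exact h.speed_le t ht
  integral_le s t hs hst := by rw [discDist_mul_left he]; exact h.integral_le s t hs hst

/-- Far from the real diameter, the projection to it is contracting. -/
theorem abs_re_stripMap_sub_le (h : IsQuasiGeodesicRay c m C) (hC : 0 ≤ C) (hs : 0 ≤ s)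
    (hst : s ≤ t) (hε : ∀ u ∈ Ioo s t, axisCos (c u) ≤ ε) :
    |(stripMap (c s)).re - (stripMap (c t)).re| ≤ ε * C * ∫ u in s..t, m u := by
  rw [abs_sub_comm, ← Complex.sub_re, ← intervalIntegral.integral_const_mul]
  refine (Complex.abs_re_le_norm _).trans <| (h.isPiecewiseC1 hs hst).norm_sub_le_integral
    isOpen_ball (h.mapsTo_ball.mono_left fun u hu => hs.trans hu.1)
    (fun w hw => (hasDerivAt_stripMap
      (mem_ball_zero_iff.1 hw)).differentiableAt.differentiableWithinAt)
    ((h.integrable s t hs hst).const_mul (ε * C)) fun u hu => ?_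
  have hu0 := hs.trans_lt hu.1
  have hlt := h.norm_lt u hu0.le
  have hpos := norm_pos_iff.2 (one_sub_sq_ne_zero hlt)
  rw [(hasDerivAt_stripMap hlt).deriv, norm_inv]
  calc ‖1 - c u ^ 2‖⁻¹ * ‖deriv c u‖
      ≤ ‖1 - c u ^ 2‖⁻¹ * (C * m u * (1 - ‖c u‖ ^ 2)) := by gcongr; exact h.speed_le u hu0
    _ = axisCos (c u) * (C * m u) := by rw [axisCos]; field_simp
    _ ≤ ε * (C * m u) := by
        gcongr
        · exact mul_nonneg hC (h.density_nonneg u)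
        · exact hε u hu
    _ = ε * C * m u := by ring

/-- An excursion away from the real diameter is short: it would save at least half its length by
following the diameter. -/
theorem integral_le_of_axisCos_le (h : IsQuasiGeodesicRay c m C) (hC : 0 ≤ C) (hs : 0 ≤ s)
    (hsr : s ≤ r) (hε : 0 < ε) (hεC : ε * C ≤ 1 / 2) (hεs : ε ≤ axisCos (c s))
    (hεr : ε ≤ axisCos (c r)) (hle : ∀ u ∈ Ioo s r, axisCos (c u) ≤ ε) :
    ∫ u in s..r, m u ≤ 2 * ε⁻¹ := by
  have hproj := h.abs_re_stripMap_sub_le hC hs hsr hle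
  have hdist := discDist_le_of_le_axisCos (h.norm_lt s hs) (h.norm_lt r (hs.trans hsr)) hε hεs hεr
  have hlen := h.integral_le s r hs hsr
  have hhalf : ε * C * ∫ u in s..r, m u ≤ 1 / 2 * ∫ u in s..r, m u := by
    gcongr
    exact intervalIntegral.integral_nonneg hsr fun u _ => h.density_nonneg u
  linarith

theorem le_axisCos (h : IsQuasiGeodesicRay c m C) (hC : 0 ≤ C) (ht : 0 ≤ t) (htT : t ≤ T)
    (hε : 0 < ε) (hεC : ε * C ≤ 1 / 2) (hstart : ε ≤ axisCos (c 0)) (hend : ε ≤ axisCos (c T)) :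
    (Real.cosh (2 * (C * (2 * ε⁻¹)) + ε⁻¹))⁻¹ ≤ axisCos (c t) := by
  have hcont := h.continuousOn_axisCos_comp
  obtain ⟨s, ⟨hs, hst⟩, hεs, hbefore⟩ :=
    exists_le_and_forall_Ioc_lt (hcont.mono Icc_subset_Ici_self) ht hstart
  obtain ⟨r, ⟨htr, -⟩, hεr, hafter⟩ :=
    exists_le_and_forall_Ico_lt (hcont.mono fun u hu => ht.trans hu.1) htT hend
  have hexcursion : ∫ u in s..r, m u ≤ 2 * ε⁻¹ :=
    h.integral_le_of_axisCos_le hC hs (hst.trans htr) hε hεC hεs hεr fun u hu =>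
      (le_or_gt u t).elim (fun hut => (hbefore u ⟨hu.1, hut⟩).le)
        fun htu => (hafter u ⟨htu.le, hu.2⟩).le
  refine le_axisCos_of_discDist_le (h.norm_lt s hs) (h.norm_lt t ht) hε hεs ?_
  calc discDist (c s) (c t) ≤ C * ∫ u in s..t, m u := h.discDist_le hs hst
    _ ≤ C * (2 * ε⁻¹) := by gcongr; exact (h.integral_mono_right hs hst htr).trans hexcursion

/-- A quasi-geodesic near the positive real axis at its end cannot lie on the negative side for
long: it has to come back near `0`. -/
theorem norm_le_tanh (h : IsQuasiGeodesicRay c m C) (hC : 0 ≤ C) (hδ : 0 < δ) (ht : 0 ≤ t)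
    (htT : t ≤ T) (hzero : c 0 = 0) (hδc : ∀ u ∈ Icc 0 T, δ ≤ axisCos (c u))
    (hneg : (stripMap (c t)).re ≤ 0) (hpos : 0 ≤ (stripMap (c T)).re) :
    ‖c t‖ ≤ Real.tanh (C * δ⁻¹) := by
  obtain ⟨r, ⟨htr, hrT⟩, hr : (stripMap (c r)).re = 0⟩ := intermediate_value_Icc htT
    (h.continuousOn_re_stripMap_comp.mono fun u hu => ht.trans hu.1) ⟨hneg, hpos⟩
  have hr0 := ht.trans htr
  have hdist := discDist_le_of_le_axisCos (h.norm_lt 0 le_rfl) (h.norm_lt r hr0) hδ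
    (hδc 0 ⟨le_rfl, ht.trans htT⟩) (hδc r ⟨hr0, hrT⟩)
  rw [hr, hzero, stripMap_zero, Complex.zero_re, sub_zero, abs_zero, add_zero, ← hzero] at hdist
  refine norm_le_tanh_of_discDist_zero_le (h.norm_lt t ht) ?_
  calc discDist 0 (c t) ≤ C * ∫ u in (0)..t, m u := by
        rw [← hzero]; exact h.discDist_le le_rfl ht
    _ ≤ C * δ⁻¹ := by
        gcongr
        exact (h.integral_mono_right le_rfl ht htr).trans
          ((h.integral_le 0 r le_rfl hr0).trans hdist)

theorem norm_one_sub_le (h : IsQuasiGeodesicRay c m C) (hC : 0 ≤ C) (hδ : 0 < δ) (ht : 0 ≤ t)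
    (htT : t ≤ T) (hzero : c 0 = 0) (hδc : ∀ u ∈ Icc 0 T, δ ≤ axisCos (c u))
    (hpos : 0 ≤ (stripMap (c T)).re) :
    ‖1 - c t‖ ≤ max (2 / δ) (2 / (1 - Real.tanh (C * δ⁻¹))) * (1 - ‖c t‖) := by
  have hlt := h.norm_lt t ht
  rcases le_total 0 (stripMap (c t)).re with hre | hre
  · exact (norm_one_sub_le_of_re_stripMap_nonneg hlt hδ (hδc t ⟨ht, htT⟩) hre).trans
      (mul_le_mul_of_nonneg_right (le_max_left _ _) (sub_pos.2 hlt).le)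
  · exact (norm_one_sub_le_of_norm_le hlt (Real.tanh_lt_one _)
      (h.norm_le_tanh hC hδ ht htT hzero hδc hre hpos)).trans
      (mul_le_mul_of_nonneg_right (le_max_right _ _) (sub_pos.2 hlt).le)

theorem exists_norm_one_sub_le (hC : 1 ≤ C) : ∃ M : ℝ, ∀ {c : ℝ → ℂ} {m : ℝ → ℝ} {t T x : ℝ},
    IsQuasiGeodesicRay c m C → c 0 = 0 → 0 ≤ t → t ≤ T → 0 ≤ x → c T = x →
      ‖1 - c t‖ ≤ M * (1 - ‖c t‖) := by
  set ε := (2 * C)⁻¹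
  have hC0 : 0 < C := one_pos.trans_le hC
  have hε : 0 < ε := by positivity
  have hε1 : ε ≤ 1 := inv_le_one_of_one_le₀ (by linarith)
  have hεC : ε * C ≤ 1 / 2 := by simp only [ε]; field_simp; rfl
  set δ := (Real.cosh (2 * (C * (2 * ε⁻¹)) + ε⁻¹))⁻¹
  have hδ : 0 < δ := inv_pos.2 (Real.cosh_pos _)
  refine ⟨_, fun {c m t T x} h hzero ht htT hx hT =>
    h.norm_one_sub_le hC0.le hδ ht htT hzero (fun u hu => ?_) ?_⟩
  all_goals
    have hx1 : |x| < 1 := by simpa [hT] using h.norm_lt T (ht.trans htT)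
  · refine h.le_axisCos hC0.le hu.1 hu.2 hε hεC ?_ (by rwa [hT, axisCos_ofReal hx1])
    rwa [hzero, ← Complex.ofReal_zero, axisCos_ofReal (by rw [abs_zero]; exact one_pos)]
  · rw [hT, stripMap_ofReal hx ((le_abs_self x).trans_lt hx1), Complex.ofReal_re]
    exact Real.artanh_nonneg hx

theorem exists_norm_div_sub_le (hC : 1 ≤ C) : ∃ M : ℝ, ∀ {c : ℝ → ℂ} {m : ℝ → ℝ} {t T : ℝ},
    IsQuasiGeodesicRay c m C → c 0 = 0 → 0 ≤ t → t ≤ T → c T ≠ 0 →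
      ‖c T / ‖c T‖ - c t‖ ≤ M * (1 - ‖c t‖) := by
  obtain ⟨M, hM⟩ := exists_norm_one_sub_le hC
  refine ⟨M, fun {c m t T} h hzero ht htT hcT => ?_⟩
  have hnorm : (‖c T‖ : ℂ) ≠ 0 := by simpa using hcT
  set e : ℂ := ‖c T‖ / c T with he_def
  have he : ‖e‖ = 1 := by simp [he_def, hcT]
  have hrot : e * (c T / ‖c T‖ - c t) = 1 - e * c t := by rw [he_def]; field_simp
  have hbound := hM (h.const_mul he) (by simp [hzero]) ht htT (norm_nonneg (c T))
    (div_mul_cancel₀ _ hcT)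
  rwa [← hrot, norm_mul, norm_mul, he, one_mul, one_mul] at hbound

/-- The vertex `σ` of the Stolz region is a limit of the directions `c T / ‖c T‖` as `T → ∞`. -/
theorem exists_norm_sub_le (h : IsQuasiGeodesicRay c m C) (hC : 1 ≤ C) (hzero : c 0 = 0)
    (hne : ∀ᶠ T in atTop, c T ≠ 0) :
    ∃ σ : ℂ, ‖σ‖ = 1 ∧ ∃ M, ∀ t, 0 ≤ t → ‖σ - c t‖ ≤ M * (1 - ‖c t‖) := by
  obtain ⟨M, hM⟩ := exists_norm_div_sub_le hC
  have hsphere : ∃ᶠ T in atTop, c T / ‖c T‖ ∈ sphere (0 : ℂ) 1 :=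
    (hne.mono fun T hT => by simp [hT]).frequently
  obtain ⟨σ, hσ, hcluster⟩ := (isCompact_sphere (0 : ℂ) 1).exists_mapClusterPt_of_frequently hsphere
  refine ⟨σ, mem_sphere_zero_iff_norm.1 hσ, M, fun t ht => ?_⟩
  have hclosed : IsClosed {e : ℂ | ‖e - c t‖ ≤ M * (1 - ‖c t‖)} :=
    isClosed_le (by fun_prop) continuous_const
  refine hclosed.mem_of_mapClusterPt hcluster ?_
  filter_upwards [hne, eventually_ge_atTop t] with T hT htT
  exact hM h hzero ht htT hT

end IsQuasiGeodesicRay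

/-! ### From non-tangential convergence to hyperbolic sectors -/

theorem tanh_sub_tanh (x y : ℝ) :
    Real.tanh x - Real.tanh y = Real.sinh (x - y) / (Real.cosh x * Real.cosh y) := by
  rw [Real.sinh_sub, Real.tanh_eq_sinh_div_cosh, Real.tanh_eq_sinh_div_cosh]
  field_simp

theorem discDist_ray {e : ℂ} (he : ‖e‖ = 1) (r s t : ℝ) :
    discDist (ray e r s) (ray e r t) = |r * s - r * t| := by
  have hcosh := mul_pos (Real.cosh_pos (r * s)) (Real.cosh_pos (r * t))
  have hsqrt : √((1 - Real.tanh (r * s) ^ 2) * (1 - Real.tanh (r * t) ^ 2)) =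
      (Real.cosh (r * s) * Real.cosh (r * t))⁻¹ := by
    rw [one_sub_sq_tanh, one_sub_sq_tanh, ← mul_inv, ← mul_pow, ← inv_pow,
      Real.sqrt_sq (by positivity)]
  rw [ray, ray, discDist_mul_left he, discDist, ← Complex.ofReal_sub, Complex.norm_real,
    Complex.norm_real, Complex.norm_real, Real.norm_eq_abs, Real.norm_eq_abs, Real.norm_eq_abs,
    sq_abs, sq_abs, hsqrt, tanh_sub_tanh, abs_div, abs_of_pos hcosh, div_inv_eq_mul,
    div_mul_cancel₀ _ hcosh.ne', Real.abs_sinh, Real.arsinh_sinh]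

theorem arsinh_le_self {x : ℝ} (hx : 0 ≤ x) : Real.arsinh x ≤ x := by
  rw [← Real.sinh_le_sinh, Real.sinh_arsinh]
  exact Real.self_le_sinh_iff.2 hx

theorem discDist_mul_norm_le {σ w : ℂ} (hσ : ‖σ‖ = 1) (hw : ‖w‖ < 1) {M : ℝ}
    (hM : ‖σ - w‖ ≤ M * (1 - ‖w‖)) : discDist w (σ * ‖w‖) ≤ M + 1 := by
  have hpos := one_sub_norm_sq_pos hw
  have hfoot : ‖σ - σ * ‖w‖‖ = 1 - ‖w‖ := by
    rw [← mul_one_sub, norm_mul, hσ, one_mul, ← Complex.ofReal_one, ← Complex.ofReal_sub,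
      Complex.norm_real, Real.norm_of_nonneg (sub_pos.2 hw).le]
  have hdist : ‖w - σ * ‖w‖‖ ≤ (M + 1) * (1 - ‖w‖) :=
    calc ‖w - σ * ‖w‖‖ ≤ ‖w - σ‖ + ‖σ - σ * ‖w‖‖ := norm_sub_le_norm_sub_add_norm_sub _ _ _
      _ ≤ (M + 1) * (1 - ‖w‖) := by rw [norm_sub_rev, hfoot]; linarith
  have hM0 : 0 ≤ M + 1 := nonneg_of_mul_nonneg_left ((norm_nonneg _).trans hdist) (sub_pos.2 hw)
  rw [discDist, norm_mul, hσ, one_mul, Complex.norm_real, norm_norm, ← sq, Real.sqrt_sq hpos.le]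
  refine (arsinh_le_self (by positivity)).trans ((div_le_iff₀ hpos).2 (hdist.trans ?_))
  gcongr
  exact pow_le_of_le_one (norm_nonneg w) hw.le two_ne_zero

theorem hypInfDist_le {U A : Set ℂ} {w a : ℂ} (ha : a ∈ A) : hypInfDist U w A ≤ hypDist U w a :=
  csInf_le ⟨0, by rintro _ ⟨b, -, rfl⟩; exact hypDist_nonneg _ _ _⟩ ⟨a, ha, rfl⟩

namespace IsRiemannMap

variable {f : ℂ → ℂ} {U : Set ℂ} {e : ℂ} {r : ℝ}

theorem hypDist_comp_ray (hf : IsRiemannMap f U) (he : ‖e‖ = 1) (r s t : ℝ) :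
    hypDist U ((f ∘ ray e r) s) ((f ∘ ray e r) t) = |r * s - r * t| :=
  (hf.hypDist_apply (norm_ray_lt he r s) (norm_ray_lt he r t)).trans (discDist_ray he r s t)

theorem isGeodesic_comp_ray (hf : IsRiemannMap f U) (he : ‖e‖ = 1) (hr : 0 < r) :
    IsGeodesic U (f ∘ ray e r) (Ici 0) := by
  refine ⟨fun t _ => hf.mem (norm_ray_lt he r t), (hf.contDiff_comp_ray he r).contDiffOn,
    fun t ht => ?_, fun s _ t _ hst => ?_⟩
  · rw [(hf.hasDerivAt_comp_ray he r t).hasDerivWithinAt.derivWithin (uniqueDiffOn_Ici 0 t ht)]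
    have hspeed : 0 < (Real.cosh (r * t) ^ 2)⁻¹ * r :=
      mul_pos (inv_pos.2 (pow_pos (Real.cosh_pos _) 2)) hr
    exact mul_ne_zero (hf.deriv_ne_zero (norm_ray_lt he r t)) (mul_ne_zero
      (norm_ne_zero_iff.1 (he ▸ one_ne_zero)) (Complex.ofReal_ne_zero.2 hspeed.ne'))
  · rw [hf.hypLength_comp_ray he hr.le, hf.hypDist_comp_ray he, ← mul_sub, abs_mul,
      abs_of_pos hr, abs_sub_comm, abs_of_nonneg (sub_nonneg.2 hst), mul_comm]

theorem tendsto_hypDist_comp_ray (hf : IsRiemannMap f U) (he : ‖e‖ = 1) (hr : 0 < r) :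
    Tendsto (fun t => hypDist U ((f ∘ ray e r) t) ((f ∘ ray e r) 0)) atTop atTop := by
  simp only [hf.hypDist_comp_ray he, mul_zero, sub_zero]
  exact tendsto_abs_atTop_atTop.comp (tendsto_id.const_mul_atTop hr)

/-- The foot on the ray of the point `w` of the Stolz region is the point of the same modulus. -/
theorem apply_mem_sector_ray (hf : IsRiemannMap f U) (he : ‖e‖ = 1) {w : ℂ} (hw : ‖w‖ < 1)
    {M : ℝ} (hM : ‖e - w‖ ≤ M * (1 - ‖w‖)) : f w ∈ sector U (f ∘ ray e 1) (M + 2) := by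
  have hfoot : ray e 1 (Real.artanh ‖w‖) = e * ‖w‖ := by
    rw [ray, one_mul, Real.tanh_artanh ⟨neg_one_lt_zero.trans_le (norm_nonneg w), hw⟩]
  refine ⟨hf.mem hw, ?_⟩
  calc hypInfDist U (f w) (f ∘ ray e 1 '' Ici 0)
      ≤ hypDist U (f w) (f (ray e 1 (Real.artanh ‖w‖))) :=
        hypInfDist_le (mem_image_of_mem _ (mem_Ici.2 (Real.artanh_nonneg (norm_nonneg w))))
    _ = discDist w (e * ‖w‖) := by rw [hf.hypDist_apply hw (norm_ray_lt he _ _), hfoot]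
    _ ≤ M + 1 := discDist_mul_norm_le he hw hM
    _ < M + 2 := by linarith

theorem exists_sector_of_convergesNonTangentially (hf : IsRiemannMap f U) {z : ℕ → ℂ}
    (hz : ∀ n, z n ∈ U) (he : ‖e‖ = 1)
    (hconv : ConvergesNonTangentially (fun n => riemannInv f (z n)) e) :
    ∃ (γ : ℝ → ℂ) (R₀ : ℝ), IsGeodesic U γ (Ici 0) ∧
      Tendsto (fun t => hypDist U (γ t) (γ 0)) atTop atTop ∧ 0 < R₀ ∧
      ∃ n₀ : ℕ, ∀ n ≥ n₀, z n ∈ sector U γ R₀ := by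
  obtain ⟨-, M, hM, hstolz⟩ := hconv
  obtain ⟨n₀, hn₀⟩ := eventually_atTop.1 hstolz
  refine ⟨f ∘ ray e 1, M + 2, hf.isGeodesic_comp_ray he one_pos,
    hf.tendsto_hypDist_comp_ray he one_pos, by linarith, n₀, fun n hn => ?_⟩
  simpa only [hf.apply_riemannInv (hz n)] using
    hf.apply_mem_sector_ray he (hf.norm_riemannInv_lt (hz n)) (hn₀ n hn).2.le

end IsRiemannMap

/-! ### From hyperbolic sectors to non-tangential convergence -/

/-- The hyperbolic disc of `U` with centre `z` and radius `R`. -/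
def hypBall (U : Set ℂ) (z : ℂ) (R : ℝ) : Set ℂ := {w | w ∈ U ∧ hypDist U z w < R}

namespace IsRiemannMap

variable {f g : ℂ → ℂ} {U V : Set ℂ} {γ : ℝ → ℂ} {a w z : ℂ} {R R₀ : ℝ}

theorem exists_apply_zero_eq (hf : IsRiemannMap f U) (hz : z ∈ U) :
    ∃ g, IsRiemannMap g U ∧ g 0 = z :=
  ⟨_, hf.comp_discAut (hf.norm_riemannInv_lt hz), by simp [discAut_zero, hf.apply_riemannInv hz]⟩

theorem hypDist_eq_artanh (hf : IsRiemannMap f U) (hw : w ∈ U) :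
    hypDist U (f 0) w = Real.artanh ‖riemannInv f w‖ := by
  simpa only [hf.apply_riemannInv hw] using hf.hypDist_apply_zero (hf.norm_riemannInv_lt hw)

theorem hypDist_comm (hf : IsRiemannMap f U) (hz : z ∈ U) (hw : w ∈ U) :
    hypDist U z w = hypDist U w z := by
  rw [hf.hypDist_eq hz hw, hf.hypDist_eq hw hz, discDist_comm]

theorem hypDist_le_of_subset (hf : IsRiemannMap f U) (hg : IsRiemannMap g V) (hUV : U ⊆ V)
    (hz : z ∈ U) (hw : w ∈ U) : hypDist V z w ≤ hypDist U z w := by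
  obtain ⟨f, hf, rfl⟩ := hf.exists_apply_zero_eq hz
  obtain ⟨g, hg, hgf⟩ := hg.exists_apply_zero_eq (hUV hz)
  have hschwarz := hg.norm_riemannInv_le_of_mapsTo hf.1 hgf.symm (hf.2.mapsTo.mono_right hUV)
    (hf.norm_riemannInv_lt hw)
  rw [hf.apply_riemannInv hw, div_one] at hschwarz
  rw [hf.hypDist_eq_artanh hw, ← hgf, hg.hypDist_eq_artanh (hUV hw)]
  exact Real.artanh_le_artanh (neg_one_lt_zero.trans_le (norm_nonneg _))
    (hf.norm_riemannInv_lt hw) hschwarz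

theorem apply_mem_hypBall_iff (hf : IsRiemannMap f U) (hw : ‖w‖ < 1) :
    f w ∈ hypBall U (f 0) R ↔ ‖w‖ < Real.tanh R := by
  rw [hypBall, mem_ofPred_eq, and_iff_right (hf.mem hw), hf.hypDist_apply_zero hw,
    ← Real.artanh_lt_artanh_iff ⟨neg_one_lt_zero.trans_le (norm_nonneg w), hw⟩
      ⟨Real.neg_one_lt_tanh R, Real.tanh_lt_one R⟩, Real.artanh_tanh]

theorem mapsTo_hypBall (hf : IsRiemannMap f U) :
    MapsTo f (ball 0 (Real.tanh R)) (hypBall U (f 0) R) := fun w hw => by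
  rw [mem_ball_zero_iff] at hw
  exact (hf.apply_mem_hypBall_iff (hw.trans (Real.tanh_lt_one R))).2 hw

theorem mem_hypBall_self (hf : IsRiemannMap f U) (hz : z ∈ U) (hR : 0 < R) :
    z ∈ hypBall U z R := by
  obtain ⟨f, hf, rfl⟩ := hf.exists_apply_zero_eq hz
  exact hf.mapsTo_hypBall (mem_ball_self (tanh_pos hR))

theorem sector_eq_iUnion (hf : IsRiemannMap f U) (hγ : MapsTo γ (Ici 0) U) :
    sector U γ R = ⋃ t ∈ Ici (0 : ℝ), hypBall U (γ t) R := by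
  ext w
  simp only [mem_iUnion₂]
  constructor
  · rintro ⟨hw, hlt⟩
    obtain ⟨_, ⟨_, ⟨t, ht, rfl⟩, rfl⟩, hdist⟩ :=
      exists_lt_of_csInf_lt ((nonempty_Ici.image γ).image (hypDist U w)) hlt
    exact ⟨t, ht, hw, (hf.hypDist_comm (hγ ht) hw).trans_lt hdist⟩
  · rintro ⟨t, ht, hw, hdist⟩
    exact ⟨hw, (hypInfDist_le (mem_image_of_mem γ ht)).trans_lt
      ((hf.hypDist_comm hw (hγ ht)).trans_lt hdist)⟩

/-- Schwarz lemma for the restriction to a disc of radius `tanh R` of a Riemann map of `U`. -/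
theorem kappa_le_of_hypBall_subset (hf : IsRiemannMap f U) (hg : IsRiemannMap g V) (hz : z ∈ U)
    (hR : 0 < R) (hsub : hypBall U z R ⊆ V) (v : ℂ) :
    kappa V z v ≤ (Real.tanh R)⁻¹ * kappa U z v := by
  have hzV := hsub (hf.mem_hypBall_self hz hR)
  obtain ⟨f, hf, rfl⟩ := hf.exists_apply_zero_eq hz
  obtain ⟨g, hg, hgf⟩ := hg.exists_apply_zero_eq hzV
  have hschwarz := hg.norm_deriv_le_of_mapsTo (tanh_pos hR)
    (hf.1.mono (ball_subset_ball (Real.tanh_lt_one R).le)) hgf.symm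
    (hf.mapsTo_hypBall.mono_right hsub)
  have hderiv := norm_pos_iff.2 (hf.deriv_ne_zero (norm_zero.trans_lt one_pos))
  have htanh := tanh_pos hR
  rw [le_div_iff₀ htanh] at hschwarz
  rw [hf.kappa_apply_zero, ← hgf, hg.kappa_apply_zero, inv_mul_eq_div, div_div]
  gcongr

theorem hypDist_le_of_hypBall_subset (hf : IsRiemannMap f U) (hg : IsRiemannMap g V) (hz : z ∈ U)
    (hR₀ : 0 < R₀) (hR : R₀ < R) (hsub : hypBall U z R ⊆ V) (hw : w ∈ hypBall U z R₀) :
    hypDist V z w ≤ Real.artanh (Real.tanh R₀ / Real.tanh R) := by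
  have htanh := tanh_pos (hR₀.trans hR)
  have hwV : w ∈ V := hsub ⟨hw.1, hw.2.trans hR⟩
  have hzV := hsub (hf.mem_hypBall_self hz (hR₀.trans hR))
  obtain ⟨f, hf, rfl⟩ := hf.exists_apply_zero_eq hz
  obtain ⟨g, hg, hgf⟩ := hg.exists_apply_zero_eq hzV
  have hnorm : ‖riemannInv f w‖ < Real.tanh R₀ := by
    rwa [← hf.apply_mem_hypBall_iff (hf.norm_riemannInv_lt hw.1), hf.apply_riemannInv hw.1]
  have hschwarz := hg.norm_riemannInv_le_of_mapsTo
    (hf.1.mono (ball_subset_ball (Real.tanh_lt_one R).le)) hgf.symm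
    (hf.mapsTo_hypBall.mono_right hsub) (hnorm.trans (tanh_lt_tanh hR))
  rw [hf.apply_riemannInv hw.1] at hschwarz
  rw [← hgf, hg.hypDist_eq_artanh hwV]
  refine Real.artanh_le_artanh (neg_one_lt_zero.trans_le (norm_nonneg _))
    ((div_lt_one htanh).2 (tanh_lt_tanh hR)) (hschwarz.trans ?_)
  gcongr

theorem norm_deriv_riemannInv_comp (hf : IsRiemannMap f U) {t : ℝ} (hγ : DifferentiableAt ℝ γ t)
    (ht : γ t ∈ U) : ‖deriv (riemannInv f ∘ γ) t‖ =
      kappa U (γ t) (deriv γ t) * (1 - ‖riemannInv f (γ t)‖ ^ 2) := by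
  have hderiv : HasDerivAt (riemannInv f ∘ γ) ((deriv f (riemannInv f (γ t)))⁻¹ * deriv γ t) t :=
    (hf.hasDerivAt_riemannInv ht).comp_of_eq t hγ.hasDerivAt rfl
  have hpos := one_sub_norm_sq_pos (hf.norm_riemannInv_lt ht)
  rw [hderiv.deriv, hf.kappa_eq ht, norm_mul, norm_inv]
  field_simp

theorem isQuasiGeodesicRay (hf : IsRiemannMap f U) (hg : IsRiemannMap g V)
    (hγ : IsGeodesic U γ (Ici 0)) (hR : 0 < R) (hsub : ∀ t, 0 ≤ t → hypBall U (γ t) R ⊆ V)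
    (hVU : V ⊆ U) :
    IsQuasiGeodesicRay (riemannInv g ∘ γ) (fun t => kappa U (γ t) (deriv γ t))
      (Real.tanh R)⁻¹ := by
  obtain ⟨hmaps, hsmooth, -, hlen⟩ := hγ
  have hmem : MapsTo γ (Ici 0) V := fun t ht => hsub t ht (hf.mem_hypBall_self (hmaps ht) hR)
  refine ⟨fun t ht => hg.norm_riemannInv_lt (hmem ht), ?_, fun t => kappa_nonneg _ _ _,
    fun s t hs hst => ?_, fun t ht => ?_, fun s t hs hst => ?_⟩
  · exact ((hg.differentiableOn_riemannInv.contDiffOn hg.isOpen).restrict_scalars ℝ).comp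
      hsmooth hmem
  · have hIcc : Icc s t ⊆ Ici 0 := fun u hu => hs.trans hu.1
    exact hf.intervalIntegrable_kappa hst (.of_contDiffOn hst (hsmooth.mono hIcc))
      (hmaps.mono_left hIcc)
  · have hd : DifferentiableAt ℝ γ t :=
      (hsmooth.differentiableOn one_ne_zero).differentiableAt (Ici_mem_nhds ht)
    rw [hg.norm_deriv_riemannInv_comp hd (hmem ht.le)]
    exact mul_le_mul_of_nonneg_right
      (hf.kappa_le_of_hypBall_subset hg (hmaps ht.le) hR (hsub t ht.le) _)
      (one_sub_norm_sq_pos (hg.norm_riemannInv_lt (hmem ht.le))).le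
  · have ht := hs.trans hst
    calc ∫ u in s..t, kappa U (γ u) (deriv γ u) = hypDist U (γ s) (γ t) := hlen s hs t ht hst
      _ ≤ hypDist V (γ s) (γ t) := hg.hypDist_le_of_subset hf hVU (hmem hs) (hmem ht)
      _ = discDist (riemannInv g (γ s)) (riemannInv g (γ t)) := hg.hypDist_eq (hmem hs) (hmem ht)

theorem tendsto_norm_riemannInv (hf : IsRiemannMap f U) {z : ℕ → ℂ} (hz : ∀ n, z n ∈ U)
    (hdiv : CompactlyDivergent U z) :
    Tendsto (fun n => ‖riemannInv f (z n)‖) atTop (𝓝 1) := by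
  refine tendsto_order.2 ⟨fun r hr => ?_, fun r hr => Eventually.of_forall fun n =>
    (hf.norm_riemannInv_lt (hz n)).trans hr⟩
  by_contra hnot
  have hfreq : ∃ᶠ n in atTop, riemannInv f (z n) ∈ closedBall (0 : ℂ) r :=
    (not_eventually.1 hnot).mono fun n hn => mem_closedBall_zero_iff.2 (not_lt.1 hn)
  obtain ⟨w, hw, hcluster⟩ :=
    (isCompact_closedBall (0 : ℂ) r).exists_mapClusterPt_of_frequently hfreq
  have hw1 : ‖w‖ < 1 := (mem_closedBall_zero_iff.1 hw).trans_lt hr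
  have himage := hcluster.continuousAt_comp (hf.differentiableAt hw1).continuousAt
  rw [show f ∘ (fun n => riemannInv f (z n)) = z from
    funext fun n => hf.apply_riemannInv (hz n)] at himage
  exact hdiv _ (hf.mem hw1) himage

theorem riemannInv_eq_discAut (hf : IsRiemannMap f U) (ha : ‖a‖ < 1) (hw : w ∈ U) :
    riemannInv f w = discAut a (riemannInv (f ∘ discAut a) w) := by
  have hcomp := hf.comp_discAut ha
  conv_lhs => rw [← hcomp.apply_riemannInv hw]
  exact hf.riemannInv_apply (norm_discAut_lt_one ha (hcomp.norm_riemannInv_lt hw))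

end IsRiemannMap

section Stolz

variable {a b σ : ℂ} {M : ℝ}

theorem norm_one_add_conj_neg_mul_le (hb : ‖b‖ < 1) :
    ‖1 + conj (-a) * b‖ ≤ (1 - ‖b‖ ^ 2) + ‖b - a‖ * ‖b‖ := by
  rw [show 1 + conj (-a) * b = (1 - conj b * b) + conj (b - a) * b by
    rw [map_sub, map_neg]; ring]
  refine (norm_add_le _ _).trans_eq ?_
  rw [norm_one_sub_conj_mul_self hb, norm_mul, Complex.norm_conj]

theorem norm_sub_le_of_discDist_le (ha : ‖a‖ < 1) (hb : ‖b‖ < 1) {ρ : ℝ} (hρ0 : 0 ≤ ρ)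
    (hρ : ρ < 1) (hdist : discDist a b ≤ Real.artanh ρ) :
    ‖b - a‖ ≤ 2 * ρ / (1 - ρ) * (1 - ‖b‖) := by
  have ha' : ‖-a‖ < 1 := by rwa [norm_neg]
  rw [discDist_eq_artanh ha hb, Real.artanh_le_artanh_iff
    ⟨neg_one_lt_zero.trans_le (norm_nonneg _), norm_discAut_lt_one ha' hb⟩
    ⟨neg_one_lt_zero.trans_le hρ0, hρ⟩, discAut, norm_div,
    div_le_iff₀ (norm_pos_iff.2 (one_add_conj_mul_ne_zero ha' hb.le)), ← sub_eq_add_neg] at hdist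
  rw [div_mul_eq_mul_div, le_div_iff₀ (sub_pos.2 hρ)]
  have hle : ‖b - a‖ ≤ ρ * (2 * (1 - ‖b‖) + ‖b - a‖) := by
    refine hdist.trans (mul_le_mul_of_nonneg_left
      ((norm_one_add_conj_neg_mul_le hb).trans (add_le_add ?_ ?_)) hρ0)
    · nlinarith [sq_nonneg (1 - ‖b‖)]
    · exact mul_le_of_le_one_right (norm_nonneg _) hb.le
  linarith

/-- Stolz regions absorb hyperbolic neighbourhoods. -/
theorem norm_sub_le_mul_of_norm_sub_le (ha : ‖a‖ < 1) {k : ℝ} (hab : ‖b - a‖ ≤ k * (1 - ‖b‖))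
    (hM : ‖σ - a‖ ≤ M * (1 - ‖a‖)) : ‖σ - b‖ ≤ (M * (1 + k) + k) * (1 - ‖b‖) := by
  have hM0 : 0 ≤ M := nonneg_of_mul_nonneg_left ((norm_nonneg _).trans hM) (sub_pos.2 ha)
  have hnorm : 1 - ‖a‖ ≤ (1 + k) * (1 - ‖b‖) := by linarith [norm_sub_norm_le b a]
  calc ‖σ - b‖ ≤ ‖σ - a‖ + ‖a - b‖ := norm_sub_le_norm_sub_add_norm_sub _ _ _
    _ ≤ M * ((1 + k) * (1 - ‖b‖)) + k * (1 - ‖b‖) := by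
        rw [norm_sub_rev a b]
        gcongr
        exact hM.trans (mul_le_mul_of_nonneg_left hnorm hM0)
    _ = (M * (1 + k) + k) * (1 - ‖b‖) := by ring

theorem div_le_one_sub_norm_discAut (ha : ‖a‖ < 1) (hb : ‖b‖ < 1) :
    (1 - ‖a‖ ^ 2) * (1 - ‖b‖) / ‖1 + conj a * b‖ ^ 2 ≤ 2 * (1 - ‖discAut a b‖) := by
  have hsq : ‖b‖ ^ 2 ≤ ‖b‖ := pow_le_of_le_one (norm_nonneg b) hb.le two_ne_zero
  calc (1 - ‖a‖ ^ 2) * (1 - ‖b‖) / ‖1 + conj a * b‖ ^ 2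
      ≤ (1 - ‖a‖ ^ 2) * (1 - ‖b‖ ^ 2) / ‖1 + conj a * b‖ ^ 2 := by
        gcongr
        exact (one_sub_norm_sq_pos ha).le
    _ = 1 - ‖discAut a b‖ ^ 2 := (one_sub_sq_norm_discAut ha hb.le).symm
    _ ≤ 2 * (1 - ‖discAut a b‖) := by linarith [sq_nonneg (1 - ‖discAut a b‖)]

/-- Automorphisms of the disc map Stolz regions into Stolz regions. -/
theorem norm_discAut_sub_discAut_le (ha : ‖a‖ < 1) (hb : ‖b‖ < 1) (hσ : ‖σ‖ = 1)
    (hM : ‖σ - b‖ ≤ M * (1 - ‖b‖)) :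
    ‖discAut a σ - discAut a b‖ ≤ 4 * M / (1 - ‖a‖) * (1 - ‖discAut a b‖) := by
  have ha1 : 0 < 1 - ‖a‖ := sub_pos.2 ha
  have hM0 : 0 ≤ M := nonneg_of_mul_nonneg_left ((norm_nonneg _).trans hM) (sub_pos.2 hb)
  have hapos := one_sub_norm_sq_pos ha
  have hypos := norm_pos_iff.2 (one_add_conj_mul_ne_zero ha hb.le)
  have hx : 1 - ‖a‖ ≤ ‖1 + conj a * σ‖ := by
    simpa [hσ] using norm_sub_norm_le (1 : ℂ) (-(conj a * σ))
  have hy : ‖1 + conj a * b‖ ≤ 2 := by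
    refine (norm_add_le _ _).trans ?_
    rw [norm_one, norm_mul, Complex.norm_conj]
    linarith [mul_le_one₀ ha.le (norm_nonneg b) hb.le]
  rw [discAut_sub_discAut ha hσ.le hb.le, norm_div, norm_mul, norm_mul,
    norm_one_sub_conj_mul_self ha]
  calc (1 - ‖a‖ ^ 2) * ‖σ - b‖ / (‖1 + conj a * σ‖ * ‖1 + conj a * b‖)
      ≤ (1 - ‖a‖ ^ 2) * (M * (1 - ‖b‖)) / ((1 - ‖a‖) * ‖1 + conj a * b‖) := by gcongr
    _ = M * ‖1 + conj a * b‖ / (1 - ‖a‖) *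
          ((1 - ‖a‖ ^ 2) * (1 - ‖b‖) / ‖1 + conj a * b‖ ^ 2) := by field_simp
    _ ≤ M * 2 / (1 - ‖a‖) * (2 * (1 - ‖discAut a b‖)) := by
        gcongr
        exact div_le_one_sub_norm_discAut ha hb
    _ = 4 * M / (1 - ‖a‖) * (1 - ‖discAut a b‖) := by ring

theorem norm_discAut_eq_one (ha : ‖a‖ < 1) (hσ : ‖σ‖ = 1) : ‖discAut a σ‖ = 1 := by
  have hsq := one_sub_sq_norm_discAut ha hσ.le
  rw [hσ, one_pow, sub_self, mul_zero, zero_div, sub_eq_zero] at hsq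
  exact (pow_eq_one_iff_of_nonneg (norm_nonneg _) two_ne_zero).1 hsq.symm

theorem convergesNonTangentially_of_norm_sub_le {ζ : ℕ → ℂ} (hζ : ∀ n, ‖ζ n‖ < 1)
    (hlim : Tendsto (fun n => ‖ζ n‖) atTop (𝓝 1))
    (hM : ∀ᶠ n in atTop, ‖σ - ζ n‖ ≤ M * (1 - ‖ζ n‖)) : ConvergesNonTangentially ζ σ := by
  constructor
  · have hzero : Tendsto (fun n => M * (1 - ‖ζ n‖)) atTop (𝓝 0) := by
      simpa using (hlim.const_sub 1).const_mul M
    rw [tendsto_iff_norm_sub_tendsto_zero]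
    refine squeeze_zero' (Eventually.of_forall fun n => norm_nonneg _) ?_ hzero
    filter_upwards [hM] with n hn
    rwa [norm_sub_rev]
  · refine ⟨max M 1 + 1, by linarith [le_max_right M 1], ?_⟩
    filter_upwards [hM] with n hn
    exact ⟨mem_ball_zero_iff.2 (hζ n), hn.trans_lt
      (mul_lt_mul_of_pos_right (by linarith [le_max_left M 1]) (sub_pos.2 (hζ n)))⟩

end Stolz

namespace IsRiemannMap

variable {f g : ℂ → ℂ} {U V : Set ℂ} {γ : ℝ → ℂ} {R R₀ : ℝ}

theorem exists_norm_sub_riemannInv_le (hf : IsRiemannMap f U) (hg : IsRiemannMap g V)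
    (hγ : IsGeodesic U γ (Ici 0)) (hinf : Tendsto (fun t => hypDist U (γ t) (γ 0)) atTop atTop)
    (hR : 0 < R) (hsub : ∀ t, 0 ≤ t → hypBall U (γ t) R ⊆ V) (hVU : V ⊆ U) (hzero : g 0 = γ 0) :
    ∃ σ : ℂ, ‖σ‖ = 1 ∧ ∃ M, ∀ t, 0 ≤ t →
      ‖σ - riemannInv g (γ t)‖ ≤ M * (1 - ‖riemannInv g (γ t)‖) := by
  refine (hf.isQuasiGeodesicRay hg hγ hR hsub hVU).exists_norm_sub_le
    ((one_le_inv₀ (tanh_pos hR)).2 (Real.tanh_lt_one R).le)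
    (by rw [Function.comp_apply, ← hzero, hg.riemannInv_apply_zero]) ?_
  filter_upwards [hinf.eventually_ne_atTop (hypDist U (γ 0) (γ 0)), eventually_ge_atTop 0]
    with t hne ht heq
  have hmem := hsub t ht (hf.mem_hypBall_self (hγ.1 ht) hR)
  refine hne (congrArg (fun w => hypDist U w (γ 0)) ?_)
  rw [← hg.apply_riemannInv hmem, ← hzero]
  exact congrArg g heq

theorem exists_norm_sub_riemannInv_le_of_mem_sector (hf : IsRiemannMap f U)
    (hg : IsRiemannMap g V) (hγ : IsGeodesic U γ (Ici 0))
    (hinf : Tendsto (fun t => hypDist U (γ t) (γ 0)) atTop atTop) (hR₀ : 0 < R₀) (hR : R₀ < R)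
    (hsub : sector U γ R ⊆ V) (hVU : V ⊆ U) :
    ∃ σ : ℂ, ‖σ‖ = 1 ∧ ∃ M, ∀ w ∈ sector U γ R₀,
      ‖σ - riemannInv g w‖ ≤ M * (1 - ‖riemannInv g w‖) := by
  rw [hf.sector_eq_iUnion hγ.1, iUnion₂_subset_iff] at hsub
  have hmem : MapsTo γ (Ici 0) V := fun t ht =>
    hsub t ht (hf.mem_hypBall_self (hγ.1 ht) (hR₀.trans hR))
  have ha := hg.norm_riemannInv_lt (hmem self_mem_Ici)
  set a := riemannInv g (γ 0)
  have hg' := hg.comp_discAut ha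
  obtain ⟨σ, hσ, M, hM⟩ := hf.exists_norm_sub_riemannInv_le hg' hγ hinf (hR₀.trans hR) hsub hVU
    (by rw [Function.comp_apply, discAut_zero, hg.apply_riemannInv (hmem self_mem_Ici)])
  have htanh := tanh_pos (hR₀.trans hR)
  set ρ := Real.tanh R₀ / Real.tanh R
  have hρ0 : 0 ≤ ρ := div_nonneg (tanh_pos hR₀).le htanh.le
  have hρ : ρ < 1 := (div_lt_one htanh).2 (tanh_lt_tanh hR)
  set k := 2 * ρ / (1 - ρ)
  refine ⟨discAut a σ, norm_discAut_eq_one ha hσ, 4 * (M * (1 + k) + k) / (1 - ‖a‖),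
    fun w hw => ?_⟩
  rw [hf.sector_eq_iUnion hγ.1, mem_iUnion₂] at hw
  obtain ⟨t, ht, hwt⟩ := hw
  have hwV : w ∈ V := hsub t ht ⟨hwt.1, hwt.2.trans hR⟩
  have hdist := hf.hypDist_le_of_hypBall_subset hg' (hγ.1 ht) hR₀ hR (hsub t ht) hwt
  rw [hg'.hypDist_eq (hmem ht) hwV] at hdist
  rw [hg.riemannInv_eq_discAut ha hwV]
  exact norm_discAut_sub_discAut_le ha (hg'.norm_riemannInv_lt hwV) hσ
    (norm_sub_le_mul_of_norm_sub_le (hg'.norm_riemannInv_lt (hmem ht))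
      (norm_sub_le_of_discDist_le (hg'.norm_riemannInv_lt (hmem ht)) (hg'.norm_riemannInv_lt hwV)
        hρ0 hρ hdist) (hM t ht))

theorem exists_convergesNonTangentially_of_sector (hf : IsRiemannMap f U) (hg : IsRiemannMap g V)
    {z : ℕ → ℂ} (hz : ∀ n, z n ∈ V) (hdiv : CompactlyDivergent V z) (hγ : IsGeodesic U γ (Ici 0))
    (hinf : Tendsto (fun t => hypDist U (γ t) (γ 0)) atTop atTop) (hR₀ : 0 < R₀) (hR : R₀ < R)
    (hsub : sector U γ R ⊆ V) (hVU : V ⊆ U) (hev : ∀ᶠ n in atTop, z n ∈ sector U γ R₀) :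
    ∃ σ : ℂ, ‖σ‖ = 1 ∧ ConvergesNonTangentially (fun n => riemannInv g (z n)) σ := by
  obtain ⟨σ, hσ, M, hM⟩ :=
    hf.exists_norm_sub_riemannInv_le_of_mem_sector hg hγ hinf hR₀ hR hsub hVU
  exact ⟨σ, hσ, convergesNonTangentially_of_norm_sub_le (fun n => hg.norm_riemannInv_lt (hz n))
    (hg.tendsto_norm_riemannInv hz hdiv) (hev.mono fun n hn => hM _ hn)⟩

end IsRiemannMap

end HypSector

theorem theorem1p1 (Δ : Set ℂ) (hΔ : HypSector.IsProperSCDomain Δ)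
    (f : ℂ → ℂ) (hf : HypSector.IsRiemannMap f Δ)
    (z : ℕ → ℂ) (hz : ∀ n, z n ∈ Δ) (hdiv : HypSector.CompactlyDivergent Δ z) :
    (∃ σ ∈ Metric.sphere (0 : ℂ) 1, HypSector.ConvergesNonTangentially
        (fun n => Function.invFunOn f (Metric.ball 0 1) (z n)) σ) ↔
      ∃ (U : Set ℂ) (γ : ℝ → ℂ) (R R₀ : ℝ),
        HypSector.IsProperSCDomain U ∧
        HypSector.IsGeodesic U γ (Set.Ici 0) ∧
        Filter.Tendsto (fun t => HypSector.hypDist U (γ t) (γ 0)) Filter.atTop Filter.atTop ∧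
        0 < R₀ ∧ R₀ < R ∧
        HypSector.sector U γ R ⊆ Δ ∧ Δ ⊆ U ∧
        ∃ n₀ : ℕ, ∀ n ≥ n₀, z n ∈ HypSector.sector U γ R₀ := by
  constructor
  · rintro ⟨σ, hσ, hconv⟩
    obtain ⟨γ, R₀, hγ, hinf, hR₀, hz₀⟩ :=
      hf.exists_sector_of_convergesNonTangentially hz (mem_sphere_zero_iff_norm.1 hσ) hconv
    exact ⟨Δ, γ, R₀ + 1, R₀, hΔ, hγ, hinf, hR₀, lt_add_one R₀, fun w hw => hw.1, Subset.rfl, hz₀⟩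
  · rintro ⟨U, γ, R, R₀, hU, hγ, hinf, hR₀, hR, hsub, hΔU, hz₀⟩
    obtain ⟨g, hg⟩ := HypSector.exists_isRiemannMap hU
    obtain ⟨σ, hσ, hconv⟩ := hg.exists_convergesNonTangentially_of_sector hf hz hdiv hγ
      hinf hR₀ hR hsub hΔU (eventually_atTop.2 hz₀)
    exact ⟨σ, mem_sphere_zero_iff_norm.2 hσ, hconv⟩
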